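/- Let $\Lambda=\{\lambda_1,\dots,\lambda_n\}$ be a set of $n$ distinct real numbers that is strongly disjoint: for any two nonempty disjoint subsets $A,B\subseteq\Lambda$ the means differ, $\mu(A)\neq\mu(B)$, where $\mu(A)=\frac1{\#A}\sum_{x\in A}x$. Let $\mathrm{Sym}(\Lambda)$ be the manifold of real symmetric $n\times n$ matrices with eigenvalue set $\Lambda$. Its tangent space at $H$ is $\{[H,\Omega]:\Omega^T=-\Omega\}$; equip it with the normal metric $g([H,\Omega_1],[H,\Omega_2])=-\mathrm{tr}(\Omega_1\Omega_2)$. Let $\mathcal H=\nabla^2\Psi$ be the Riemannian Hessian, with respect to the Levi-Civita connection of $g$, of the diagonal potential $\Psi(H)=\frac12\sum_{i}d_i^2$, where $d_1,\dots,d_n$ are the diagonal entries of $H$. For an ordered partition $\alpha=(\Lambda_1,\dots,\Lambda_k)$ of $\Lambda$ into nonempty sets, with $n_i=\#\Lambda_i$, let $$E_\alpha=\{\mathrm{Diag}(H_1,\dots,H_k)\;:\;H_i\in\mathrm{Sym}(\Lambda_i)\text{ and all diagonal entries of }H_i\text{ equal }\mu(\Lambda_i)\}.$$ The sets $P^TE_\alpha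 P$ with $P$ a permutation matrix are called critical manifolds. For a submanifold $E$ of $\mathrm{Sym}(\Lambda)$ and $H\in E$, let $N_HE$ be the $g$-orthogonal complement of $T_HE$ in $T_H\mathrm{Sym}(\Lambda)$. **Theorem.** 1. For every $\alpha$ and every $H\in E_\alpha$, the restriction of $\mathcal H$ to $N_HE_\alpha$ is nondegenerate. 2. More precisely, let $H=\mathrm{Diag}(H_1,\dots,H_k)\in E_\alpha$. For each $p$ let $\lambda_{p1}<\dots<\lambda_{pn_p}$ be the elements of $\Lambda_p$, let $v_{p1},\dots,v_{pn_p}$ be unit eigenvectors of $H_p$ for these eigenvalues, and let $u_{p,1},\dots,u_{p,n_p-1}$ be an orthonormal basis of the hyperplane $(1,\dots,1)^\perp\subset\mathbb R^{n_p}$. For $p<q$, $1\le i\le n_p$, $1\le j\le n_q$ let $N_{pq,ij}$ be the symmetric matrix whose $pq$-th block is $(\lambda_{pi}-\lambda_{qj})v_{pi}v_{qj}^T$, whose $qp$-th block is the transpose of this, and whose other blocks vanish. Then there are skew symmetric $n_p\times n_p$ matrices $\Omega_{p,t}$ ($1\le p\le k$, $1\le t\le n_p-1$) such that the diagonal of $[H_p,\Omega_{p,t}]$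 is $u_{p,t}$ and such that, with $N_{p,t}$ the block-diagonal matrix with $p$-th diagonal block $[H_p,\Omega_{p,t}]$ and other blocks zero, the family $\mathcal N_o\cup\mathcal N_d=\{N_{pq,ij}\}\cup\{N_{p,t}\}$ is a basis of $N_HE_\alpha$ that is orthogonal with respect to $\mathcal H$, with $$\mathcal H(N_{pq,ij},N_{pq,ij})=-2(\lambda_{pi}-\lambda_{qj})(\mu(\Lambda_p)-\mu(\Lambda_q))\neq0,\qquad \mathcal H(N_{p,t},N_{p,t})=1.$$ 3. $\mathcal H$ is invariant under conjugation by permutation matrices: $\mathcal H_{P^THP}(P^TXP,P^TYP)=\mathcal H_H(X,Y)$ for every permutation matrix $P$, every $H\in\mathrm{Sym}(\Lambda)$ and all $X,Y\in T_H\mathrm{Sym}(\Lambda)$. Consequently $\mathcal H$ is also nondegenerate on the normal space at every point of every critical manifold $P^TE_\alpha P$. 4. $\Psi$ is a Morse–Bott function on $(\mathrm{Sym}(\Lambda),g)$: the set of zeros of $\mathrm{grad}\,\Psi$ is a finite disjoint union of connected embedded submanifolds $E_1,\dots,E_m$, and the Hessian of $\Psi$ is nondegenerate on $N_HE_i$ for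 all $i$ and all $H\in E_i$. -/

import Mathlib

open Matrix Polynomial
open scoped Topology ContDiff Matrix.Norms.Frobenius

noncomputable section

namespace DiagPotential

/-! ### Embedded submanifolds of a vector space -/

section Submanifold

variable {V : Type*} [NormedAddCommGroup V] [NormedSpace ℝ V]

/-- `S` is an embedded smooth `d`-dimensional submanifold of `V` (slice charts): near each of
its points some smooth diffeomorphism between open subsets of `V` carries `S` to a `d`-dimensional
linear subspace. -/
def IsSubmanifold (S : Set V) (d : ℕ) : Prop :=
  ∀ x ∈ S, ∃ (Φ : OpenPartialHomeomorph V V) (L : Submodule ℝ V),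
    x ∈ Φ.source ∧ ContDiffOn ℝ ∞ Φ Φ.source ∧ ContDiffOn ℝ ∞ Φ.symm Φ.target ∧
    Module.finrank ℝ L = d ∧ ∀ y ∈ Φ.source, (y ∈ S ↔ Φ y ∈ L)

/-- The tangent space of a submanifold `S` at `x`, as a subspace of `V`: the (span of the)
velocities at time `0` of the smooth curves in `S` through `x`. -/
def tangentSpaceAt (S : Set V) (x : V) : Submodule ℝ V :=
  Submodule.span ℝ {v | ∃ γ : ℝ → V, ContDiffAt ℝ ∞ γ 0 ∧ γ 0 = x ∧
    (∀ᶠ t in 𝓝 (0 : ℝ), γ t ∈ S) ∧ deriv γ 0 = v}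

end Submanifold

/-! ### The isospectral manifold -/

/-- The arithmetic mean `μ(A)` of a finite set of real numbers. -/
def mean (A : Finset ℝ) : ℝ := (∑ x ∈ A, x) / (A.card : ℝ)

/-- Disjoint nonempty subsets of `Λ` have different means. -/
def StronglyDisjoint (Λ : Finset ℝ) : Prop :=
  ∀ A B : Finset ℝ, A ⊆ Λ → B ⊆ Λ → A.Nonempty → B.Nonempty → Disjoint A B → mean A ≠ mean B

/-- Square matrices whose size is the number of elements of `Λ`. -/
abbrev Mat (Λ : Finset ℝ) : Type := Matrix (Fin Λ.card) (Fin Λ.card) ℝ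

/-- The isospectral manifold `Sym(Λ)`: the real symmetric matrices of size `#Λ` whose eigenvalues
are the elements of `Λ`, each of them simple. -/
def isoSym (Λ : Finset ℝ) : Set (Mat Λ) :=
  {H | Hᵀ = H ∧ H.charpoly = ∏ l ∈ Λ, (X - C l)}

section Geometry

variable {n : ℕ}

/-- `Ω` is skew symmetric. -/
def IsSkew (Ω : Matrix (Fin n) (Fin n) ℝ) : Prop := Ωᵀ = -Ω

/-- The tangent space of the isospectral manifold at `H`: all `[H, Ω]` with `Ω` skew symmetric. -/
def isoTangent (H : Matrix (Fin n) (Fin n) ℝ) : Set (Matrix (Fin n) (Fin n) ℝ) :=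
  {X | ∃ Ω, IsSkew Ω ∧ ⁅H, Ω⁆ = X}

open Classical in
/-- The skew symmetric `Ω` with `[H, Ω] = X`, for a tangent vector `X` at `H`; it is unique
when the eigenvalues of the symmetric matrix `H` are distinct. -/
def adInv (H X : Matrix (Fin n) (Fin n) ℝ) : Matrix (Fin n) (Fin n) ℝ :=
  if h : ∃ Ω, IsSkew Ω ∧ ⁅H, Ω⁆ = X then h.choose else 0

/-- The normal metric `g([H, Ω₁], [H, Ω₂]) = -tr(Ω₁ Ω₂)`. -/
def normalMetric (H X Y : Matrix (Fin n) (Fin n) ℝ) : ℝ :=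
  -(adInv H X * adInv H Y).trace

/-- The vector field `A ↦ [A, Ω]`. -/
def fundField (Ω A : Matrix (Fin n) (Fin n) ℝ) : Matrix (Fin n) (Fin n) ℝ := ⁅A, Ω⁆

/-- The curve `t ↦ exp(-tΩ) H exp(tΩ)` through `H`, with velocity `[H, Ω]` at `t = 0`. -/
def orbitCurve (H Ω : Matrix (Fin n) (Fin n) ℝ) (t : ℝ) : Matrix (Fin n) (Fin n) ℝ :=
  NormedSpace.exp (-(t • Ω)) * H * NormedSpace.exp (t • Ω)

/-- The derivative at `H` of a (real or matrix valued) function on the isospectral manifold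
in the direction of the tangent vector `X`, taken along a curve in the manifold with velocity `X`
at `H`. -/
def dirDeriv {E : Type*} [NormedAddCommGroup E] [NormedSpace ℝ E]
    (F : Matrix (Fin n) (Fin n) ℝ → E) (H X : Matrix (Fin n) (Fin n) ℝ) : E :=
  deriv (fun t : ℝ => F (orbitCurve H (adInv H X) t)) 0

/-- `W` is the gradient of `f` at `H` for the normal metric. -/
def IsGradientAt (f : Matrix (Fin n) (Fin n) ℝ → ℝ) (H W : Matrix (Fin n) (Fin n) ℝ) : Prop :=
  W ∈ isoTangent H ∧ ∀ Z ∈ isoTangent H, normalMetric H W Z = dirDeriv f H Z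

/-- The Lie bracket of two vector fields on the isospectral manifold. -/
def bracketField (X Y : Matrix (Fin n) (Fin n) ℝ → Matrix (Fin n) (Fin n) ℝ)
    (H : Matrix (Fin n) (Fin n) ℝ) : Matrix (Fin n) (Fin n) ℝ :=
  dirDeriv Y H (X H) - dirDeriv X H (Y H)

/-- The right-hand side of the Koszul formula, which is `g(∇_X Y, Z)` at `H` for the Levi-Civita
connection `∇` of the normal metric `g`. -/
def koszul (X Y Z : Matrix (Fin n) (Fin n) ℝ → Matrix (Fin n) (Fin n) ℝ)
    (H : Matrix (Fin n) (Fin n) ℝ) : ℝ :=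
  (1 / 2 : ℝ) *
    (dirDeriv (fun A => normalMetric A (Y A) (Z A)) H (X H)
      + dirDeriv (fun A => normalMetric A (Z A) (X A)) H (Y H)
      - dirDeriv (fun A => normalMetric A (X A) (Y A)) H (Z H)
      + normalMetric H (bracketField X Y H) (Z H)
      - normalMetric H (bracketField Y Z H) (X H)
      + normalMetric H (bracketField Z X H) (Y H))

open Classical in
/-- The Levi-Civita covariant derivative `∇_X Y` at `H` for the normal metric: the tangent vector
determined by the Koszul formula. -/
def leviCivita (X Y : Matrix (Fin n) (Fin n) ℝ → Matrix (Fin n) (Fin n) ℝ)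
    (H : Matrix (Fin n) (Fin n) ℝ) : Matrix (Fin n) (Fin n) ℝ :=
  if h : ∃ W, W ∈ isoTangent H ∧
      ∀ Ω, IsSkew Ω → normalMetric H W (fundField Ω H) = koszul X Y (fundField Ω) H
  then h.choose else 0

/-- The Hessian `(∇²f)(X, Y) = X(Y f) - (∇_X Y) f` on vector fields, at the point `H`. -/
def hessianField (f : Matrix (Fin n) (Fin n) ℝ → ℝ)
    (X Y : Matrix (Fin n) (Fin n) ℝ → Matrix (Fin n) (Fin n) ℝ)
    (H : Matrix (Fin n) (Fin n) ℝ) : ℝ :=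
  dirDeriv (fun A => dirDeriv f A (Y A)) H (X H) - dirDeriv f H (leviCivita X Y H)

/-- The Riemannian Hessian of `f` at `H` on two tangent vectors. As `∇²f` is a tensor, any
extensions of the vectors to vector fields may be used; here `[H, Ω]` is extended by
`A ↦ [A, Ω]`. -/
def hessian (f : Matrix (Fin n) (Fin n) ℝ → ℝ) (H X Y : Matrix (Fin n) (Fin n) ℝ) : ℝ :=
  hessianField f (fundField (adInv H X)) (fundField (adInv H Y)) H

/-- The normal space at `H` of a submanifold `E` of the isospectral manifold, for the normal
metric. -/
def normalSpace (E : Set (Matrix (Fin n) (Fin n) ℝ)) (H : Matrix (Fin n) (Fin n) ℝ) :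
    Set (Matrix (Fin n) (Fin n) ℝ) :=
  {X | X ∈ isoTangent H ∧ ∀ Y ∈ tangentSpaceAt E H, normalMetric H X Y = 0}

/-- The form `B` is nondegenerate when restricted to `N`. -/
def NondegenerateOn {V : Type*} [Zero V] (B : V → V → ℝ) (N : Set V) : Prop :=
  (∀ X ∈ N, (∀ Y ∈ N, B X Y = 0) → X = 0) ∧ (∀ Y ∈ N, (∀ X ∈ N, B X Y = 0) → Y = 0)

/-- The diagonal potential `½ ∑ dᵢ²`. -/
def diagPotential (H : Matrix (Fin n) (Fin n) ℝ) : ℝ := (1 / 2 : ℝ) * ∑ i, (H i i) ^ 2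

/-- Conjugation `A ↦ Pᵀ A P` by the permutation matrix `P` of `σ`. -/
def permConj (σ : Equiv.Perm (Fin n)) (A : Matrix (Fin n) (Fin n) ℝ) :
    Matrix (Fin n) (Fin n) ℝ :=
  (σ.permMatrix ℝ)ᵀ * A * σ.permMatrix ℝ

end Geometry

/-- `Ψ` is a Morse-Bott function on `Sym(Λ)` with the normal metric: it is smooth, the zero set of
its gradient is a finite disjoint union of connected submanifolds, and at each point of each of
them the Hessian is nondegenerate on the normal space. -/
def IsMorseBott (Λ : Finset ℝ) (Ψ : Mat Λ → ℝ) : Prop :=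
  (∃ Ψ' : Mat Λ → ℝ, ContDiff ℝ ∞ Ψ' ∧ Set.EqOn Ψ Ψ' (isoSym Λ)) ∧
  ∃ (m : ℕ) (E : Fin m → Set (Mat Λ)),
    {H | H ∈ isoSym Λ ∧ IsGradientAt Ψ H 0} = ⋃ i, E i ∧
    Pairwise (Function.onFun Disjoint E) ∧
    ∀ i, IsConnected (E i) ∧ (∃ d, IsSubmanifold (E i) d) ∧
      ∀ H ∈ E i, NondegenerateOn (hessian Ψ H) (normalSpace (E i) H)

/-! ### Partitions and the sets `E_α` -/

/-- An ordered partition `(Λ₁, …, Λ_k)` of `Λ` into nonempty sets. -/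
structure OrderedPartition (Λ : Finset ℝ) where
  k : ℕ
  part : Fin k → Finset ℝ
  nonempty : ∀ i, (part i).Nonempty
  disjoint : Pairwise (Function.onFun Disjoint part)
  cover : Finset.univ.biUnion part = Λ

namespace OrderedPartition

variable {Λ : Finset ℝ} (α : OrderedPartition Λ)

/-- The size `n_i` of the `i`-th part. -/
abbrev size (i : Fin α.k) : ℕ := (α.part i).card

theorem sum_size : ∑ i, α.size i = Λ.card := by
  conv_rhs => rw [← α.cover]
  rw [Finset.card_biUnion]
  intro i _ j _ hij
  exact α.disjoint hij

/-- The `a`-th row of the `i`-th block is the row number `n_1 + ⋯ + n_{i-1} + a`. -/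
def blockEquiv : (Σ i : Fin α.k, Fin (α.size i)) ≃ Fin Λ.card :=
  finSigmaFinEquiv.trans (finCongr α.sum_size)

/-- Families `(B_1, …, B_k)` of square matrices of the sizes of the parts. -/
abbrev Blocks : Type := ∀ i : Fin α.k, Matrix (Fin (α.size i)) (Fin (α.size i)) ℝ

/-- The block-diagonal matrix `Diag(B_1, …, B_k)`. -/
def diag (B : α.Blocks) : Mat Λ :=
  Matrix.reindex α.blockEquiv α.blockEquiv (Matrix.blockDiagonal' B)

/-- `B_i` lies in `Sym(Λ_i)` and its diagonal entries equal `μ(Λ_i)`, for every `i`. -/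
def IsCritical (B : α.Blocks) : Prop :=
  ∀ i, B i ∈ isoSym (α.part i) ∧ ∀ a, B i a a = mean (α.part i)

/-- The critical manifold `E_α`. -/
def E : Set (Mat Λ) := {H | ∃ B : α.Blocks, α.IsCritical B ∧ α.diag B = H}

/-- The eigenvalues `λ_{i1} < ⋯ < λ_{in_i}` that form the `i`-th part. -/
def eig (i : Fin α.k) (a : Fin (α.size i)) : ℝ := (α.part i).orderEmbOfFin rfl a

/-- The vector in `ℝⁿ` whose `p`-th block is `v` and whose other blocks are zero. -/
def extend (p : Fin α.k) (v : Fin (α.size p) → ℝ) : Fin Λ.card → ℝ := fun x =>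
  (Pi.single p v : ∀ i : Fin α.k, Fin (α.size i) → ℝ)
    (α.blockEquiv.symm x).1 (α.blockEquiv.symm x).2

/-- Index set `{(p, q, i, j) | p < q}` of the off block-diagonal basis vectors. -/
abbrev OffIndex : Type :=
  Σ pq : {pq : Fin α.k × Fin α.k // pq.1 < pq.2}, Fin (α.size pq.1.1) × Fin (α.size pq.1.2)

/-- Index set `{(i, j) | 1 ≤ j ≤ n_i - 1}` of the block-diagonal basis vectors. -/
abbrev DiagIndex : Type := Σ i : Fin α.k, Fin (α.size i - 1)

/-- `N_{pq,ij}`: the symmetric matrix with `pq`-th block `(λ_{pi} - λ_{qj}) v_{pi} v_{qj}ᵀ`, with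
the transpose of this as `qp`-th block, and with all other blocks zero. -/
def offVec (v : ∀ i : Fin α.k, Fin (α.size i) → Fin (α.size i) → ℝ) (x : α.OffIndex) : Mat Λ :=
  (α.eig x.1.1.1 x.2.1 - α.eig x.1.1.2 x.2.2) •
    (vecMulVec (α.extend x.1.1.1 (v _ x.2.1)) (α.extend x.1.1.2 (v _ x.2.2)) +
      vecMulVec (α.extend x.1.1.2 (v _ x.2.2)) (α.extend x.1.1.1 (v _ x.2.1)))

/-- `N_{i,j}`: the matrix with `i`-th diagonal block `[B_i, Ω_{i,j}]` and all other blocks zero. -/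
def diagVec (B : α.Blocks)
    (Ω : ∀ i : Fin α.k, Fin (α.size i - 1) → Matrix (Fin (α.size i)) (Fin (α.size i)) ℝ)
    (y : α.DiagIndex) : Mat Λ :=
  α.diag (Pi.single y.1 ⁅B y.1, Ω y.1 y.2⁆)

/-- `v_{i1}, …, v_{in_i}` are unit eigenvectors of `B_i` for the eigenvalues
`λ_{i1}, …, λ_{in_i}`. -/
def IsUnitEigen (B : α.Blocks) (v : ∀ i : Fin α.k, Fin (α.size i) → Fin (α.size i) → ℝ) : Prop :=
  ∀ i a, B i *ᵥ v i a = α.eig i a • v i a ∧ v i a ⬝ᵥ v i a = 1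

/-- `u_{i,1}, …, u_{i,n_i-1}` is an orthonormal basis of the hyperplane `(1, …, 1)^⊥` of
`ℝ^{n_i}`, for every `i`. -/
def IsHyperplaneBasis (u : ∀ i : Fin α.k, Fin (α.size i - 1) → Fin (α.size i) → ℝ) : Prop :=
  ∀ i, (∀ j, ∑ a, u i j a = 0) ∧ ∀ j j', u i j ⬝ᵥ u i j' = if j = j' then 1 else 0

end OrderedPartition

end DiagPotential

end

open DiagPotential

/-! Write `d` for the diagonal of `H`. The trace identity `∑ f_i [H, Ω]_ii = tr([Diag(f), H] Ω)`
(`sum_mul_diag_lie`) gives `dΨ([H, Ω]) = tr([Diag(d), H] Ω)`. As `[Diag(d), H]` is skew, `H` is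
critical iff it commutes with `Diag(d)`, that is, iff `H` is block diagonal along the level sets of
`d`. The critical points with diagonal `d` form `critSlice Λ d`; each `d_i` is then the mean of a
part of the spectrum, so only finitely many `d` occur.

Strong disjointness enters twice. It makes a subset of `Λ` determined by its size and mean, so `E_α`
is a full slice (`E_eq_critSlice`). It also forces a diagonal matrix commuting with a point of the
slice to be constant on the level sets of `d` (`eq_of_diagonal_lie_eq_zero`): otherwise a block
would split into two with equal means. Since `∑ e_i [H, [Diag(e), H]]_ii = tr([Diag(e), H]²)` is
negative unless `[Diag(e), H] = 0`, every vector with zero level sums is the diagonal of some `[H,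
[Diag(e), H]]` (`exists_diag_lie_eq`). This surjectivity gives the defining function `critFun` the
range needed to straighten its zero set. So the slice is a submanifold, whose tangent vectors are
the `[H, Ω]` that commute with `Diag(d)` and have zero diagonal.

For the fields `A ↦ [A, Ω]` the connection is `[H, ½[Ω₁, Ω₂]]`, and its contribution to the Hessian
vanishes at critical points, leaving `⟨diag X, diag Y⟩ + tr([Diag(d), X] Ω₂)` with `Y = [H, Ω₂]`
(`hessian_eq_of_mem_critSlice`). Take eigenvectors common to `H` and `Diag(d)`. Wedges of
eigenvectors from different levels give normal vectors whose pairing with `X` reads off one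
off-block coordinate of `X`. Once these coordinates vanish, the Hessian is the inner product of
diagonals, and a normal vector that commutes with `Diag(d)` and has zero diagonal is also tangent,
hence zero. The same computation yields the explicit basis, its diagonal part being of the form `[H,
[Diag(f), H]]`.

For Morse–Bott, the slices are compact and locally connected, so their connected components form a
finite family of submanifolds. -/

namespace DiagPotential

/-! ### Orthonormal eigenbases and the bracket in their coordinates -/

section Eigenframe

variable {n : ℕ} {ι : Type*} [Fintype ι] [DecidableEq ι]

/-- The columns of `Q` are an orthonormal basis of eigenvectors of `H`, with distinct
eigenvalues `l`. -/
structure IsEigenframe (H : Matrix (Fin n) (Fin n) ℝ) (Q : Matrix (Fin n) ι ℝ) (l : ι → ℝ) :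
    Prop where
  orth : Qᵀ * Q = 1
  orth' : Q * Qᵀ = 1
  mul_eq : H * Q = Q * diagonal l
  inj : Function.Injective l

namespace IsEigenframe

variable {H : Matrix (Fin n) (Fin n) ℝ} {Q : Matrix (Fin n) ι ℝ} {l : ι → ℝ}

theorem ext_coord (h : IsEigenframe H Q l) {A B : Matrix (Fin n) (Fin n) ℝ}
    (hAB : Qᵀ * A * Q = Qᵀ * B * Q) : A = B := by
  have key : ∀ C : Matrix (Fin n) (Fin n) ℝ, Q * (Qᵀ * C * Q) * Qᵀ = C := fun C => by
    rw [Matrix.mul_assoc Qᵀ, ← Matrix.mul_assoc Q, h.orth', Matrix.one_mul, Matrix.mul_assoc,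
      h.orth', Matrix.mul_one]
  rw [← key A, hAB, key]

theorem coord_of (h : IsEigenframe H Q l) (N : Matrix ι ι ℝ) :
    Qᵀ * (Q * N * Qᵀ) * Q = N := by
  rw [Matrix.mul_assoc, Matrix.mul_assoc, h.orth, Matrix.mul_one, ← Matrix.mul_assoc, h.orth,
    Matrix.one_mul]

theorem eq_conj (h : IsEigenframe H Q l) {A : Matrix (Fin n) (Fin n) ℝ} {a : ι → ℝ}
    (hA : A * Q = Q * diagonal a) : A = Q * diagonal a * Qᵀ := by
  rw [← hA, Matrix.mul_assoc, h.orth', Matrix.mul_one]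

theorem transpose_mul (h : IsEigenframe H Q l) {A : Matrix (Fin n) (Fin n) ℝ} {a : ι → ℝ}
    (hA : A * Q = Q * diagonal a) : Qᵀ * A = diagonal a * Qᵀ := by
  rw [h.eq_conj hA, ← Matrix.mul_assoc, ← Matrix.mul_assoc, h.orth, Matrix.one_mul]

/-- In the frame `A` becomes `diagonal a`, and bracketing with a diagonal matrix scales each entry.
-/
theorem coord_lie (h : IsEigenframe H Q l) {A : Matrix (Fin n) (Fin n) ℝ} {a : ι → ℝ}
    (hA : A * Q = Q * diagonal a) (X : Matrix (Fin n) (Fin n) ℝ) (i j : ι) :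
    (Qᵀ * ⁅A, X⁆ * Q) i j = (a i - a j) * (Qᵀ * X * Q) i j := by
  have : Qᵀ * ⁅A, X⁆ * Q = diagonal a * (Qᵀ * X * Q) - (Qᵀ * X * Q) * diagonal a := by
    rw [Ring.lie_def, Matrix.mul_sub, Matrix.sub_mul, ← Matrix.mul_assoc, h.transpose_mul hA,
      Matrix.mul_assoc (Qᵀ * X), ← hA]
    simp only [Matrix.mul_assoc]
  rw [this, Matrix.sub_apply, diagonal_mul, mul_diagonal]
  ring

/-- A matrix commuting with `H` is diagonal in an eigenframe of `H`. -/
theorem exists_mul_eq_of_commute (h : IsEigenframe H Q l) {A : Matrix (Fin n) (Fin n) ℝ}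
    (hA : ⁅A, H⁆ = 0) : ∃ a : ι → ℝ, A * Q = Q * diagonal a := by
  refine ⟨fun i => (Qᵀ * A * Q) i i, ?_⟩
  have hd : Qᵀ * A * Q = diagonal fun i => (Qᵀ * A * Q) i i := by
    ext i j
    by_cases hij : i = j
    · subst hij; simp
    · have h0 := h.coord_lie h.mul_eq A i j
      rw [show ⁅H, A⁆ = 0 by rw [Ring.lie_def, ← neg_sub, ← Ring.lie_def, hA, neg_zero]] at h0
      simp only [Matrix.mul_zero, Matrix.zero_mul, Matrix.zero_apply, zero_eq_mul,
        sub_eq_zero] at h0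
      rw [diagonal_apply_ne _ hij, h0.resolve_left fun e => hij (h.inj e)]
  rw [← hd, ← Matrix.mul_assoc, ← Matrix.mul_assoc, h.orth', Matrix.one_mul]

theorem symm (h : IsEigenframe H Q l) : Hᵀ = H := by
  rw [h.eq_conj h.mul_eq]
  simp [Matrix.mul_assoc]

/-- The map `Ω ↦ [H, Ω]` is injective on skew symmetric matrices. -/
theorem eq_zero_of_lie_eq_zero (h : IsEigenframe H Q l) {Ω : Matrix (Fin n) (Fin n) ℝ}
    (hΩ : IsSkew Ω) (h0 : ⁅H, Ω⁆ = 0) : Ω = 0 := by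
  apply h.ext_coord
  ext i j
  by_cases hij : i = j
  · subst hij
    have : (Qᵀ * Ω * Q)ᵀ = -(Qᵀ * Ω * Q) := by
      rw [Matrix.transpose_mul, Matrix.transpose_mul, transpose_transpose, hΩ]
      simp [Matrix.mul_assoc]
    have := congrFun (congrFun this i) i
    simp only [transpose_apply, Matrix.neg_apply] at this
    simp only [Matrix.mul_zero, Matrix.zero_mul, Matrix.zero_apply]
    linarith
  · have h1 := h.coord_lie h.mul_eq Ω i j
    rw [h0] at h1
    simp only [Matrix.mul_zero, Matrix.zero_mul, Matrix.zero_apply, zero_eq_mul, sub_eq_zero] at h1 ⊢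
    exact h1.resolve_left fun e => hij (h.inj e)

/-- A symmetric matrix with zero diagonal in an eigenframe of `H` is tangent at `H`. -/
theorem mem_isoTangent (h : IsEigenframe H Q l) {X : Matrix (Fin n) (Fin n) ℝ} (hX : Xᵀ = X)
    (h0 : ∀ i, (Qᵀ * X * Q) i i = 0) : X ∈ isoTangent H := by
  have hs : (Qᵀ * X * Q)ᵀ = Qᵀ * X * Q := by
    rw [Matrix.transpose_mul, Matrix.transpose_mul, transpose_transpose, hX, Matrix.mul_assoc]
  -- By `coord_lie` the equation `[H, Ω] = X` is solved entrywise by division; on the diagonal the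
  -- quotient by `0` is `0`, as skewness requires.
  let N : Matrix ι ι ℝ := Matrix.of fun i j => (Qᵀ * X * Q) i j / (l i - l j)
  have hN : Nᵀ = -N := by
    ext i j
    have := congrFun (congrFun hs i) j
    rw [transpose_apply] at this
    simp only [N, transpose_apply, of_apply, Matrix.neg_apply, this]
    rw [← div_neg, neg_sub]
  refine ⟨Q * N * Qᵀ, ?_, ?_⟩
  · rw [IsSkew, Matrix.transpose_mul, Matrix.transpose_mul, transpose_transpose, hN]
    simp [Matrix.mul_assoc]
  · apply h.ext_coord
    ext i j
    rw [h.coord_lie h.mul_eq, h.coord_of]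
    by_cases hij : i = j
    · subst hij; simp [h0]
    · have : l i - l j ≠ 0 := sub_ne_zero.2 fun e => hij (h.inj e)
      simp only [N, of_apply]
      field_simp

/-- Eigenvectors of a symmetric matrix for distinct eigenvalues are orthogonal, and by the count of
indices the left inverse `Qᵀ` is also a right inverse. -/
theorem of_unit_eigenvectors (hH : Hᵀ = H) (w : ι → Fin n → ℝ) (hl : Function.Injective l)
    (hw : ∀ i, H *ᵥ w i = l i • w i) (hu : ∀ i, w i ⬝ᵥ w i = 1) (hc : Fintype.card ι = n) :
    IsEigenframe H (Matrix.of fun x i => w i x) l := by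
  have ho : (Matrix.of fun x i => w i x)ᵀ * (Matrix.of fun x i => w i x) = (1 : Matrix ι ι ℝ) := by
    ext i j
    have e : ((Matrix.of fun x i => w i x)ᵀ * (Matrix.of fun x i => w i x)) i j = w i ⬝ᵥ w j := by
      simp [Matrix.mul_apply, dotProduct]
    rw [e]
    by_cases hij : i = j
    · subst hij; simp [hu]
    · rw [Matrix.one_apply_ne hij]
      have h1 : w i ⬝ᵥ (H *ᵥ w j) = (H *ᵥ w i) ⬝ᵥ w j := by
        rw [Matrix.dotProduct_mulVec, ← Matrix.mulVec_transpose, hH]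
      rw [hw, hw, dotProduct_smul, smul_dotProduct, smul_eq_mul, smul_eq_mul] at h1
      have : l j - l i ≠ 0 := sub_ne_zero.2 fun e => hij (hl e.symm)
      have h2 : (l j - l i) * (w i ⬝ᵥ w j) = 0 := by linarith
      exact (mul_eq_zero.1 h2).resolve_left this
  refine ⟨ho, (Matrix.mul_eq_one_comm_of_card_eq _ _ _ (by simp [hc])).1 ho, ?_, hl⟩
  ext x i
  rw [mul_diagonal]
  have := congrFun (hw i) x
  simp only [Pi.smul_apply, smul_eq_mul] at this
  rw [of_apply, mul_comm, ← this]
  rfl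

end IsEigenframe

/-- The distinct factors `X - C l` are coprime, so their product divides the characteristic
polynomial, and monicity and degree force equality. The spectral condition thus becomes a system of
smooth equations. -/
theorem mem_isoSym_iff_det {Λ : Finset ℝ} {H : Mat Λ} :
    H ∈ isoSym Λ ↔ Hᵀ = H ∧
      ∀ i, (scalar (Fin Λ.card) (Λ.orderEmbOfFin rfl i) - H).det = 0 := by
  have hp : ∏ l ∈ Λ, (X - C l) = ∏ i : Fin Λ.card, (X - C (Λ.orderEmbOfFin rfl i)) := by
    have := Finset.prod_map Finset.univ (Λ.orderEmbOfFin rfl).toEmbedding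
      (fun l => (X - C l : ℝ[X]))
    simpa using this
  simp only [isoSym, Set.mem_ofPred_eq, ← Matrix.eval_charpoly]
  refine and_congr_right fun _ => ⟨fun h i => ?_, fun h => ?_⟩
  · rw [h, hp, eval_prod]
    exact Finset.prod_eq_zero (Finset.mem_univ i) (by simp)
  · have hdvd : ∏ l ∈ Λ, (X - C l) ∣ H.charpoly := by
      refine Finset.prod_dvd_of_coprime ?_ ?_
      · intro a _ b _ hab
        exact pairwise_coprime_X_sub_C Function.injective_id hab
      · intro a ha
        rw [dvd_iff_isRoot]
        have : a ∈ Set.range (Λ.orderEmbOfFin rfl) := by simpa using ha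
        obtain ⟨i, rfl⟩ := this
        exact h i
    refine (Polynomial.eq_of_monic_of_dvd_of_natDegree_le (monic_prod_X_sub_C _ _)
      H.charpoly_monic hdvd ?_)
    rw [H.charpoly_natDegree_eq_dim, natDegree_finsetProd_X_sub_C_eq_card]
    simp

theorem exists_isEigenframe {Λ : Finset ℝ} {H : Mat Λ} (hH : H ∈ isoSym Λ) :
    ∃ Q : Mat Λ, IsEigenframe H Q (Λ.orderEmbOfFin rfl) := by
  have hd := (mem_isoSym_iff_det.1 hH).2
  have : ∀ i, ∃ w : Fin Λ.card → ℝ,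
      H *ᵥ w = Λ.orderEmbOfFin rfl i • w ∧ w ⬝ᵥ w = 1 := by
    intro i
    obtain ⟨v, hv0, hv⟩ := Matrix.exists_mulVec_eq_zero_iff.2 (hd i)
    rw [Matrix.sub_mulVec, sub_eq_zero] at hv
    have hpos : 0 < v ⬝ᵥ v :=
      lt_of_le_of_ne (Finset.sum_nonneg fun i _ => mul_self_nonneg _)
        (fun e => hv0 (dotProduct_self_eq_zero.1 e.symm))
    refine ⟨(Real.sqrt (v ⬝ᵥ v))⁻¹ • v, ?_, ?_⟩
    · rw [mulVec_smul, ← hv, smul_comm]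
      simp
    · rw [smul_dotProduct, dotProduct_smul, smul_smul, smul_eq_mul, ← mul_inv,
        Real.mul_self_sqrt hpos.le, inv_mul_cancel₀ hpos.ne']
  choose w hw hu using this
  exact ⟨_, IsEigenframe.of_unit_eigenvectors hH.1 w (Λ.orderEmbOfFin rfl).injective hw hu
    (by simp)⟩

end Eigenframe

/-! ### Normal metric, Levi-Civita connection and Hessian on orbit fields -/

section Orbit

theorem matrix_trace_lie_mul {m R : Type*} [Fintype m] [CommRing R] (A B C : Matrix m m R) :
    (⁅A, B⁆ * C).trace = (A * ⁅B, C⁆).trace := by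
  rw [Ring.lie_def, Ring.lie_def, Matrix.sub_mul, Matrix.mul_sub, trace_sub, trace_sub,
    Matrix.mul_assoc, Matrix.trace_mul_cycle B A C, Matrix.trace_mul_cycle C B A, Matrix.mul_assoc]

theorem trace_diagonal_mul_eq_sum {n : ℕ} (d : Fin n → ℝ) (A : Matrix (Fin n) (Fin n) ℝ) :
    (diagonal d * A).trace = ∑ i, d i * A i i := by
  simp [Matrix.trace, diagonal_mul]

variable {n : ℕ}

theorem IsSkew.lie {Ω₁ Ω₂ : Matrix (Fin n) (Fin n) ℝ} (h₁ : IsSkew Ω₁) (h₂ : IsSkew Ω₂) :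
    IsSkew ⁅Ω₁, Ω₂⁆ := by
  unfold IsSkew at *
  rw [Ring.lie_def, transpose_sub, Matrix.transpose_mul, Matrix.transpose_mul, h₁, h₂]
  simp

theorem IsSkew.smul {Ω : Matrix (Fin n) (Fin n) ℝ} (h : IsSkew Ω) (c : ℝ) : IsSkew (c • Ω) := by
  unfold IsSkew at *
  rw [transpose_smul, h, smul_neg]

theorem IsSkew.add {Ω₁ Ω₂ : Matrix (Fin n) (Fin n) ℝ} (h₁ : IsSkew Ω₁) (h₂ : IsSkew Ω₂) :
    IsSkew (Ω₁ + Ω₂) := by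
  unfold IsSkew at *
  rw [transpose_add, h₁, h₂, neg_add]

theorem isSkew_zero : IsSkew (0 : Matrix (Fin n) (Fin n) ℝ) := by simp [IsSkew]

theorem lie_transpose_of_skew {H Ω : Matrix (Fin n) (Fin n) ℝ} (hH : Hᵀ = H) (h : IsSkew Ω) :
    ⁅H, Ω⁆ᵀ = ⁅H, Ω⁆ := by
  unfold IsSkew at h
  rw [Ring.lie_def, transpose_sub, Matrix.transpose_mul, Matrix.transpose_mul, h, hH]
  noncomm_ring

theorem eq_zero_of_isSkew_of_trace {Ω : Matrix (Fin n) (Fin n) ℝ} (h : IsSkew Ω)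
    (h0 : (Ω * Ω).trace = 0) : Ω = 0 := by
  unfold IsSkew at h
  apply Matrix.trace_mul_conjTranspose_self_eq_zero_iff.1
  rw [conjTranspose_eq_transpose_of_trivial, h, Matrix.mul_neg, trace_neg, h0, neg_zero]

theorem exp_neg_mul_exp (Ω : Matrix (Fin n) (Fin n) ℝ) :
    NormedSpace.exp (-Ω) * NormedSpace.exp Ω = 1 := by
  rw [← Matrix.exp_add_of_commute _ _ (Commute.refl Ω).neg_left]
  simp

theorem orbitCurve_zero (H Ω : Matrix (Fin n) (Fin n) ℝ) : orbitCurve H Ω 0 = H := by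
  simp [orbitCurve]

theorem hasDerivAt_orbitCurve (H Ω : Matrix (Fin n) (Fin n) ℝ) :
    HasDerivAt (orbitCurve H Ω) ⁅H, Ω⁆ 0 := by
  have h1 : HasDerivAt (fun t : ℝ => NormedSpace.exp (t • Ω)) Ω 0 := by
    exact (hasDerivAt_exp_smul_const (𝕂 := ℝ) Ω (0 : ℝ)).congr_deriv (by simp)
  have h2 : HasDerivAt (fun t : ℝ => NormedSpace.exp (-(t • Ω))) (-Ω) 0 := by
    simp_rw [← smul_neg]
    exact (hasDerivAt_exp_smul_const (𝕂 := ℝ) (-Ω) (0 : ℝ)).congr_deriv (by simp)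
  refine ((h2.mul_const H).mul h1).congr_deriv ?_
  simp [Ring.lie_def]
  noncomm_ring

variable {Λ : Finset ℝ} {H : Mat Λ}

theorem orbitCurve_mem_isoSym (hH : H ∈ isoSym Λ) {Ω : Mat Λ} (hΩ : IsSkew Ω) (t : ℝ) :
    orbitCurve H Ω t ∈ isoSym Λ := by
  have hs := hΩ.smul t
  unfold IsSkew at hs
  have e1 : (NormedSpace.exp (t • Ω))ᵀ = NormedSpace.exp (-(t • Ω)) := by
    rw [← Matrix.exp_transpose, hs]
  have e2 : (NormedSpace.exp (-(t • Ω)))ᵀ = NormedSpace.exp (t • Ω) := by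
    rw [← Matrix.exp_transpose, transpose_neg, hs, neg_neg]
  refine ⟨?_, ?_⟩
  · rw [orbitCurve, Matrix.transpose_mul, Matrix.transpose_mul, e1, e2, hH.1, Matrix.mul_assoc]
  · have h2 := exp_neg_mul_exp (-(t • Ω))
    rw [neg_neg] at h2
    rw [← hH.2, orbitCurve, Matrix.charpoly_mul_comm, ← Matrix.mul_assoc, h2, Matrix.one_mul]

/-- Simplicity of the spectrum makes `Ω` unique, so the choice made in `adInv` is the expected one;
metric and derivatives are computed through this. -/
theorem adInv_lie (hH : H ∈ isoSym Λ) {Ω : Mat Λ} (hΩ : IsSkew Ω) : adInv H ⁅H, Ω⁆ = Ω := by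
  obtain ⟨Q, hQ⟩ := exists_isEigenframe hH
  have hex : ∃ Ω', IsSkew Ω' ∧ ⁅H, Ω'⁆ = ⁅H, Ω⁆ := ⟨Ω, hΩ, rfl⟩
  rw [adInv, dif_pos hex]
  obtain ⟨h1, h2⟩ := hex.choose_spec
  rw [← sub_eq_zero]
  refine hQ.eq_zero_of_lie_eq_zero ?_ ?_
  · simpa [sub_eq_add_neg] using h1.add (hΩ.smul (-1))
  · rw [← sub_eq_zero.2 h2]
    simp only [Ring.lie_def]
    noncomm_ring

theorem normalMetric_lie (hH : H ∈ isoSym Λ) {Ω₁ Ω₂ : Mat Λ} (h₁ : IsSkew Ω₁) (h₂ : IsSkew Ω₂) :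
    normalMetric H ⁅H, Ω₁⁆ ⁅H, Ω₂⁆ = -(Ω₁ * Ω₂).trace := by
  rw [normalMetric, adInv_lie hH h₁, adInv_lie hH h₂]

theorem dirDeriv_eq_of_hasFDerivAt {E : Type*} [NormedAddCommGroup E] [NormedSpace ℝ E]
    {F : Mat Λ → E} {F' : Mat Λ →L[ℝ] E} (hH : H ∈ isoSym Λ) {Ω : Mat Λ} (hΩ : IsSkew Ω)
    (hF : HasFDerivAt F F' H) : dirDeriv F H ⁅H, Ω⁆ = F' ⁅H, Ω⁆ := by
  rw [dirDeriv, adInv_lie hH hΩ]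
  rw [← orbitCurve_zero H Ω] at hF
  exact (hF.comp_hasDerivAt 0 (hasDerivAt_orbitCurve H Ω)).deriv

/-- The orbit curve stays in `isoSym Λ`, so only values there matter. This permits replacing a
function by a formula valid on the manifold only. -/
theorem dirDeriv_congr {E : Type*} [NormedAddCommGroup E] [NormedSpace ℝ E]
    {F G : Mat Λ → E} (hH : H ∈ isoSym Λ) {Ω : Mat Λ} (hΩ : IsSkew Ω)
    (hFG : Set.EqOn F G (isoSym Λ)) : dirDeriv F H ⁅H, Ω⁆ = dirDeriv G H ⁅H, Ω⁆ := by
  rw [dirDeriv, dirDeriv, adInv_lie hH hΩ]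
  congr 1
  ext t
  exact hFG (orbitCurve_mem_isoSym hH hΩ t)

theorem dirDeriv_of_const {F : Mat Λ → ℝ} (hH : H ∈ isoSym Λ) {Ω : Mat Λ} (hΩ : IsSkew Ω) {c : ℝ}
    (hF : ∀ A ∈ isoSym Λ, F A = c) : dirDeriv F H ⁅H, Ω⁆ = 0 := by
  rw [dirDeriv_congr (G := fun _ => c) hH hΩ fun A hA => hF A hA]
  simp [dirDeriv]

theorem dirDeriv_fundField (hH : H ∈ isoSym Λ) {Ω : Mat Λ} (hΩ : IsSkew Ω) (Ω' : Mat Λ) :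
    dirDeriv (fundField Ω') H ⁅H, Ω⁆ = ⁅⁅H, Ω⁆, Ω'⁆ := by
  let L : Mat Λ →L[ℝ] Mat Λ := LinearMap.toContinuousLinearMap
    { toFun := fun A => ⁅A, Ω'⁆
      map_add' := fun A B => by simp only [Ring.lie_def]; noncomm_ring
      map_smul' := fun c A => by simp [Ring.lie_def, smul_sub] }
  exact dirDeriv_eq_of_hasFDerivAt hH hΩ L.hasFDerivAt

theorem bracketField_fundField (hH : H ∈ isoSym Λ) {Ω₁ Ω₂ : Mat Λ} (h₁ : IsSkew Ω₁)
    (h₂ : IsSkew Ω₂) : bracketField (fundField Ω₁) (fundField Ω₂) H = ⁅H, ⁅Ω₁, Ω₂⁆⁆ := by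
  rw [bracketField, show fundField Ω₁ H = ⁅H, Ω₁⁆ from rfl, show fundField Ω₂ H = ⁅H, Ω₂⁆ from rfl,
    dirDeriv_fundField hH h₁, dirDeriv_fundField hH h₂]
  simp only [Ring.lie_def]
  noncomm_ring

theorem normalMetric_fundField {A : Mat Λ} (hA : A ∈ isoSym Λ) {Ω₁ Ω₂ : Mat Λ}
    (h₁ : IsSkew Ω₁) (h₂ : IsSkew Ω₂) :
    normalMetric A (fundField Ω₁ A) (fundField Ω₂ A) = -(Ω₁ * Ω₂).trace :=
  normalMetric_lie hA h₁ h₂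

/-- The metric is constant on pairs of fields `A ↦ [A, Ω]`, so the three derivative terms vanish;
the three bracket terms agree up to sign by invariance of the trace. -/
theorem koszul_fundField (hH : H ∈ isoSym Λ) {Ω₁ Ω₂ Ω₃ : Mat Λ} (h₁ : IsSkew Ω₁)
    (h₂ : IsSkew Ω₂) (h₃ : IsSkew Ω₃) :
    koszul (fundField Ω₁) (fundField Ω₂) (fundField Ω₃) H = -(1 / 2) * (⁅Ω₁, Ω₂⁆ * Ω₃).trace := by
  have d : ∀ {Ω Ω' Ω'' : Mat Λ}, IsSkew Ω → IsSkew Ω' → IsSkew Ω'' →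
      dirDeriv (fun A => normalMetric A (fundField Ω A) (fundField Ω' A)) H (fundField Ω'' H) = 0 :=
    fun h h' h'' => dirDeriv_of_const hH h'' fun A hA => normalMetric_fundField hA h h'
  rw [koszul, d h₂ h₃ h₁, d h₃ h₁ h₂, d h₁ h₂ h₃, bracketField_fundField hH h₁ h₂,
    bracketField_fundField hH h₂ h₃, bracketField_fundField hH h₃ h₁]
  simp only [fundField]
  rw [normalMetric_lie hH (h₁.lie h₂) h₃, normalMetric_lie hH (h₂.lie h₃) h₁,
    normalMetric_lie hH (h₃.lie h₁) h₂, matrix_trace_lie_mul Ω₃ Ω₁ Ω₂,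
    Matrix.trace_mul_comm Ω₃, matrix_trace_lie_mul Ω₁ Ω₂ Ω₃, Matrix.trace_mul_comm Ω₁]
  ring

theorem leviCivita_fundField (hH : H ∈ isoSym Λ) {Ω₁ Ω₂ : Mat Λ} (h₁ : IsSkew Ω₁)
    (h₂ : IsSkew Ω₂) :
    leviCivita (fundField Ω₁) (fundField Ω₂) H = ⁅H, (1 / 2 : ℝ) • ⁅Ω₁, Ω₂⁆⁆ := by
  have hs : IsSkew ((1 / 2 : ℝ) • ⁅Ω₁, Ω₂⁆) := (h₁.lie h₂).smul _
  have hex : ∃ W, W ∈ isoTangent H ∧ ∀ Ω, IsSkew Ω →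
      normalMetric H W (fundField Ω H) = koszul (fundField Ω₁) (fundField Ω₂) (fundField Ω) H := by
    refine ⟨_, ⟨_, hs, rfl⟩, fun Ω hΩ => ?_⟩
    rw [koszul_fundField hH h₁ h₂ hΩ, fundField, normalMetric_lie hH hs hΩ]
    simp
  rw [leviCivita, dif_pos hex]
  obtain ⟨⟨Ω, hΩ, e⟩, h⟩ := hex.choose_spec
  rw [← e]
  rw [← e] at h
  -- The trace form is definite on skew matrices, so it suffices to test the Koszul identity against
  -- the difference itself.
  have key : Ω - (1 / 2 : ℝ) • ⁅Ω₁, Ω₂⁆ = 0 := by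
    have hd : IsSkew (Ω - (1 / 2 : ℝ) • ⁅Ω₁, Ω₂⁆) := by
      simpa [sub_eq_add_neg] using hΩ.add (hs.smul (-1))
    apply eq_zero_of_isSkew_of_trace hd
    have := h _ hd
    rw [koszul_fundField hH h₁ h₂ hd, fundField, normalMetric_lie hH hΩ hd] at this
    rw [Matrix.sub_mul, trace_sub, Matrix.smul_mul, trace_smul, smul_eq_mul]
    linarith
  rw [sub_eq_zero.1 key]

theorem contDiff_entry (i j : Fin n) :
    ContDiff ℝ ∞ fun A : Matrix (Fin n) (Fin n) ℝ => A i j :=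
  (LinearMap.toContinuousLinearMap (Matrix.entryLinearMap ℝ ℝ i j)).contDiff

theorem contDiff_diagPotential :
    ContDiff ℝ ∞ (diagPotential : Matrix (Fin n) (Fin n) ℝ → ℝ) :=
  contDiff_const.mul (ContDiff.sum fun i _ => (contDiff_entry i i).pow 2)

theorem hasDerivAt_entry {γ : ℝ → Matrix (Fin n) (Fin n) ℝ} {X : Matrix (Fin n) (Fin n) ℝ} {t : ℝ}
    (hγ : HasDerivAt γ X t) (i j : Fin n) : HasDerivAt (fun s => γ s i j) (X i j) t :=
  (LinearMap.toContinuousLinearMap (Matrix.entryLinearMap ℝ ℝ i j)).hasFDerivAt.comp_hasDerivAt t hγ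

theorem dirDeriv_diagPotential (hH : H ∈ isoSym Λ) {Ω : Mat Λ} (hΩ : IsSkew Ω) :
    dirDeriv diagPotential H ⁅H, Ω⁆ = ∑ i, H i i * ⁅H, Ω⁆ i i := by
  have := (HasDerivAt.fun_sum (u := Finset.univ)
    fun i _ => (hasDerivAt_entry (hasDerivAt_orbitCurve H Ω) i i).pow 2).const_mul (1 / 2 : ℝ)
  rw [dirDeriv, adInv_lie hH hΩ]
  refine this.deriv.trans ?_
  rw [orbitCurve_zero, Finset.mul_sum]
  refine Finset.sum_congr rfl fun i _ => ?_
  push_cast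
  ring

theorem hessian_lie (hH : H ∈ isoSym Λ) {Ω₁ Ω₂ : Mat Λ} (h₁ : IsSkew Ω₁) (h₂ : IsSkew Ω₂) :
    hessian diagPotential H ⁅H, Ω₁⁆ ⁅H, Ω₂⁆ =
      ∑ i, ⁅H, Ω₁⁆ i i * ⁅H, Ω₂⁆ i i + ∑ i, H i i * ⁅⁅H, Ω₁⁆, Ω₂⁆ i i
        - ∑ i, H i i * ⁅H, (1 / 2 : ℝ) • ⁅Ω₁, Ω₂⁆⁆ i i := by
  rw [hessian, adInv_lie hH h₁, adInv_lie hH h₂, hessianField, leviCivita_fundField hH h₁ h₂,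
    dirDeriv_diagPotential hH ((h₁.lie h₂).smul _)]
  congr 1
  simp only [fundField]
  rw [dirDeriv_congr hH h₁ fun A hA => dirDeriv_diagPotential hA h₂]
  let L : Mat Λ →ₗ[ℝ] Mat Λ :=
    { toFun := fun A => ⁅A, Ω₂⁆
      map_add' := fun A B => by simp only [Ring.lie_def]; noncomm_ring
      map_smul' := fun c A => by simp [Ring.lie_def, smul_sub] }
  have hγ := hasDerivAt_orbitCurve H Ω₁
  have := HasDerivAt.fun_sum (u := Finset.univ) fun i _ => (hasDerivAt_entry hγ i i).mul
    (hasDerivAt_entry ((LinearMap.toContinuousLinearMap L).hasFDerivAt.comp_hasDerivAt 0 hγ) i i)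
  rw [dirDeriv, adInv_lie hH h₁]
  refine this.deriv.trans ?_
  rw [← Finset.sum_add_distrib]
  refine Finset.sum_congr rfl fun i _ => ?_
  simp only [Function.comp, orbitCurve_zero]
  rfl

end Orbit

/-! ### Distribution of the spectrum over diagonal blocks -/

section Spectrum

/-- A factorization of `∏ (X - l)` into monic factors comes from a family of disjoint subsets of
the set of roots. -/
theorem exists_factor_roots {κ : Type*} {Λ : Finset ℝ} {s : Finset κ} {p : κ → ℝ[X]}
    (hm : ∀ i ∈ s, (p i).Monic) (hp : ∏ i ∈ s, p i = ∏ l ∈ Λ, (X - C l)) :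
    ∃ A : κ → Finset ℝ, (∀ i ∈ s, A i ⊆ Λ ∧ p i = ∏ l ∈ A i, (X - C l)) ∧
      (s : Set κ).Pairwise fun i j => Disjoint (A i) (A j) := by
  classical
  have hne : (∏ l ∈ Λ, (X - C l : ℝ[X])) ≠ 0 := (monic_prod_X_sub_C _ _).ne_zero
  have hle : ∀ {q : ℝ[X]}, q ∣ ∏ i ∈ s, p i → q.roots ≤ Λ.val := fun hq => by
    rw [← roots_prod_X_sub_C Λ, ← hp]
    exact roots.le_of_dvd (hp ▸ hne) hq
  refine ⟨fun i => (p i).roots.toFinset, fun i hi => ?_, fun i hi j hj hij => ?_⟩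
  · have hd := Finset.dvd_prod_of_mem p hi
    have hnd : (p i).roots.Nodup := Multiset.nodup_of_le (hle hd) Λ.nodup
    refine ⟨fun x hx => ?_, ?_⟩
    · exact Multiset.mem_of_le (hle hd) (Multiset.mem_toFinset.1 hx)
    · have hs : (p i).Splits := by
        rw [hp] at hd
        exact (Splits.prod fun l _ => Splits.X_sub_C l).of_dvd hne hd
      conv_lhs => rw [hs.eq_prod_roots_of_monic (hm i hi)]
      rw [Finset.prod, Multiset.toFinset_val, hnd.dedup]
  -- A root common to `p i` and `p j` would be a double root of the product, whose roots are simple.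
  · have hd : p i * p j ∣ ∏ k ∈ s, p k := by
      rw [← Finset.prod_pair hij]
      exact Finset.prod_dvd_prod_of_subset _ _ _ (by
        intro x; simp only [Finset.mem_insert, Finset.mem_singleton]; rintro (rfl | rfl) <;> assumption)
    have h := Multiset.nodup_of_le (hle hd) Λ.nodup
    rw [roots_mul (mul_ne_zero (hm i hi).ne_zero (hm j hj).ne_zero), Multiset.nodup_add] at h
    exact Multiset.disjoint_toFinset.2 h.2.2

/-- The spectrum of a matrix in `Sym(Λ)` is distributed over its diagonal blocks. -/
theorem exists_block_spectrum {Λ : Finset ℝ} {H : Mat Λ} (hH : H ∈ isoSym Λ) {κ : Type*}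
    [LinearOrder κ] (f : Fin Λ.card → κ) (hf : ∀ i j, f i ≠ f j → H i j = 0) :
    ∃ A : κ → Finset ℝ, (∀ c ∈ Finset.univ.image f, A c ⊆ Λ ∧
        (A c).card = (Finset.univ.filter fun i => f i = c).card ∧
        ∑ x ∈ A c, x = ∑ i with f i = c, H i i) ∧
      ((Finset.univ.image f : Finset κ) : Set κ).Pairwise fun c c' => Disjoint (A c) (A c') := by
  have hb : H.BlockTriangular f := fun i j hij => hf i j (ne_of_gt hij)
  obtain ⟨A, hA, hdis⟩ := exists_factor_roots (s := Finset.univ.image f)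
    (p := fun c => (H.toSquareBlock f c).charpoly) (fun c _ => Matrix.charpoly_monic _)
    (by rw [← hb.charpoly, hH.2])
  refine ⟨A, fun c hc => ⟨(hA c hc).1, ?_, ?_⟩, hdis⟩
  · have := congrArg natDegree (hA c hc).2
    rw [Matrix.charpoly_natDegree_eq_dim, natDegree_finsetProd_X_sub_C_eq_card] at this
    rw [← this, Fintype.card_subtype]
  · have h := (H.toSquareBlock f c).trace_eq_neg_charpoly_nextCoeff
    rw [(hA c hc).2, prod_X_sub_C_nextCoeff, neg_neg] at h
    rw [← h, Matrix.trace, Finset.sum_subtype (p := fun i => f i = c) _ (by simp)]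
    rfl

end Spectrum

/-! ### Critical points with prescribed diagonal -/

section CritSlice

variable {n : ℕ}

theorem diagonal_lie_apply (d : Fin n → ℝ) (A : Matrix (Fin n) (Fin n) ℝ) (i j : Fin n) :
    ⁅diagonal d, A⁆ i j = (d i - d j) * A i j := by
  rw [Ring.lie_def, Matrix.sub_apply, diagonal_mul, mul_diagonal]
  ring

theorem diagonal_lie_eq_zero_iff {d : Fin n → ℝ} {A : Matrix (Fin n) (Fin n) ℝ} :
    ⁅diagonal d, A⁆ = 0 ↔ ∀ i j, d i ≠ d j → A i j = 0 := by
  refine ⟨fun h i j hij => ?_, fun h => ?_⟩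
  · have := congrFun (congrFun h i) j
    rw [diagonal_lie_apply] at this
    exact (mul_eq_zero.1 this).resolve_left (sub_ne_zero.2 hij)
  · ext i j
    rw [diagonal_lie_apply]
    by_cases hij : d i = d j
    · simp [hij]
    · simp [h i j hij]

/-- The matrices in `Sym(Λ)` with diagonal `d` that commute with `Diag(d)`. -/
def critSlice (Λ : Finset ℝ) (d : Fin Λ.card → ℝ) : Set (Mat Λ) :=
  {H | H ∈ isoSym Λ ∧ (∀ i, H i i = d i) ∧ ⁅diagonal d, H⁆ = 0}

/-- The vectors whose entries sum to zero over each level set of `d`. -/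
def levelSumZero (d : Fin n → ℝ) : Submodule ℝ (Fin n → ℝ) where
  carrier := {u | ∀ i, ∑ j with d j = d i, u j = 0}
  add_mem' := fun {u v} hu hv i => by
    simp only [Set.mem_ofPred_eq] at hu hv
    simp [Finset.sum_add_distrib, hu i, hv i]
  zero_mem' := fun i => by simp
  smul_mem' := fun c u hu i => by
    simp only [Set.mem_ofPred_eq] at hu
    simp [← Finset.mul_sum, hu i]

theorem mem_levelSumZero {d u : Fin n → ℝ} :
    u ∈ levelSumZero d ↔ ∀ i, ∑ j with d j = d i, u j = 0 := Iff.rfl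

/-- `levelSumZero d` meets the vectors constant on the level sets only in zero. -/
theorem eq_zero_of_mem_levelSumZero {d u : Fin n → ℝ} (hu : u ∈ levelSumZero d)
    (hc : ∀ i j, d i = d j → u i = u j) : u = 0 := by
  ext i
  have h := mem_levelSumZero.1 hu i
  rw [Finset.sum_congr rfl fun j hj => hc j i (Finset.mem_filter.1 hj).2, Finset.sum_const,
    nsmul_eq_mul] at h
  refine (mul_eq_zero.1 h).resolve_left ?_
  exact_mod_cast (Finset.card_pos.2 ⟨i, by simp⟩).ne'

/-- Invariance of the trace. This duality between diagonals of tangent vectors and commutators with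
diagonal matrices drives the whole argument. -/
theorem sum_mul_diag_lie (f : Fin n → ℝ) (H Ω : Matrix (Fin n) (Fin n) ℝ) :
    ∑ i, f i * ⁅H, Ω⁆ i i = (⁅diagonal f, H⁆ * Ω).trace := by
  rw [matrix_trace_lie_mul, trace_diagonal_mul_eq_sum]

theorem diag_lie_mem_levelSumZero {d : Fin n → ℝ} {H : Matrix (Fin n) (Fin n) ℝ}
    (hH : ⁅diagonal d, H⁆ = 0) (Ω : Matrix (Fin n) (Fin n) ℝ) :
    (fun i => ⁅H, Ω⁆ i i) ∈ levelSumZero d := by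
  intro i
  -- The indicator of a level set of `d` gives a diagonal matrix that commutes with `H`.
  have h := sum_mul_diag_lie (fun j => if d j = d i then 1 else 0) H Ω
  rw [diagonal_lie_eq_zero_iff.2, Matrix.zero_mul, trace_zero] at h
  · simpa [Finset.sum_filter] using h
  · intro j k hjk
    exact diagonal_lie_eq_zero_iff.1 hH j k fun e => hjk (by simp [e])

theorem isSkew_lie_of_symm {A B : Matrix (Fin n) (Fin n) ℝ} (hA : Aᵀ = A) (hB : Bᵀ = B) :
    IsSkew ⁅A, B⁆ := by
  rw [IsSkew, Ring.lie_def, transpose_sub, Matrix.transpose_mul, Matrix.transpose_mul, hA, hB,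
    neg_sub]

variable {Λ : Finset ℝ} {d : Fin Λ.card → ℝ} {H : Mat Λ}

theorem StronglyDisjoint.subset {Λ' : Finset ℝ} (hΛ : StronglyDisjoint Λ) (h : Λ' ⊆ Λ) :
    StronglyDisjoint Λ' :=
  fun A B hA hB => hΛ A B (hA.trans h) (hB.trans h)

/-- A diagonal matrix commuting with a critical point is constant on the level sets of the
diagonal of that point: otherwise two disjoint parts of the spectrum would have equal means. -/
theorem eq_of_diagonal_lie_eq_zero (hΛ : StronglyDisjoint Λ) (hH : H ∈ critSlice Λ d)
    {e : Fin Λ.card → ℝ} (he : ⁅diagonal e, H⁆ = 0) {i j : Fin Λ.card} (hij : d i = d j) :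
    e i = e j := by
  by_contra hne
  -- `H` vanishes between different values of the pair `(d, e)`. The blocks of `i` and `j` for this
  -- finer partition carry disjoint parts of the spectrum, both with mean `d i = d j`. The
  -- lexicographic order only supplies the linear order required for block triangularity.
  let f : Fin Λ.card → ℝ ×ₗ ℝ := fun k => toLex (d k, e k)
  obtain ⟨A, hA, hdis⟩ := exists_block_spectrum hH.1 f fun a b hab => by
    by_cases h : d a = d b
    · refine diagonal_lie_eq_zero_iff.1 he a b fun h' => hab ?_
      simp [f, h, h']
    · exact diagonal_lie_eq_zero_iff.1 hH.2.2 a b h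
  have hmem : ∀ k, f k ∈ Finset.univ.image f := fun k => Finset.mem_image_of_mem f (Finset.mem_univ k)
  have hcard : ∀ k, (A (f k)).Nonempty := fun k => by
    rw [← Finset.card_pos, (hA _ (hmem k)).2.1, Finset.card_pos]
    exact ⟨k, by simp⟩
  have hmean : ∀ k, mean (A (f k)) = d k := fun k => by
    obtain ⟨_, hc, hs⟩ := hA _ (hmem k)
    rw [mean, hs, hc, Finset.sum_congr rfl (g := fun _ => d k), Finset.sum_const, nsmul_eq_mul,
      mul_div_cancel_left₀]
    · rw [← hc]
      exact_mod_cast (hcard k).card_pos.ne'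
    · intro l hl
      rw [hH.2.1]
      have : f l = f k := (Finset.mem_filter.1 hl).2
      exact congrArg Prod.fst (congrArg ofLex this)
  refine hΛ _ _ (hA _ (hmem i)).1 (hA _ (hmem j)).1 (hcard i) (hcard j)
    (hdis (hmem i) (hmem j) fun h => hne ?_) (by rw [hmean, hmean, hij])
  exact congrArg Prod.snd (congrArg ofLex h)

/-- The block of `i` has constant diagonal `d i`, so its trace shows `d i` to be the mean of its
eigenvalues. The possible diagonals are therefore finite in number. -/
theorem mem_image_mean_of_mem_critSlice (hH : H ∈ critSlice Λ d) (i : Fin Λ.card) :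
    d i ∈ Λ.powerset.image mean := by
  obtain ⟨A, hA, -⟩ := exists_block_spectrum hH.1 d (diagonal_lie_eq_zero_iff.1 hH.2.2)
  obtain ⟨hs, hc, hsum⟩ := hA (d i) (Finset.mem_image_of_mem d (Finset.mem_univ i))
  refine Finset.mem_image.2 ⟨A (d i), Finset.mem_powerset.2 hs, ?_⟩
  rw [mean, hsum, hc, Finset.sum_congr rfl (g := fun _ => d i), Finset.sum_const, nsmul_eq_mul,
    mul_div_cancel_left₀]
  · rw [Nat.cast_ne_zero, ← Nat.pos_iff_ne_zero, Finset.card_pos]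
    exact ⟨i, by simp⟩
  · intro l hl
    rw [hH.2.1, (Finset.mem_filter.1 hl).2]

/-- At a critical point every vector with vanishing level sums is the diagonal of a tangent
vector `[H, [Diag(e), H]]`. -/
theorem exists_diag_lie_eq (hΛ : StronglyDisjoint Λ) (hH : H ∈ critSlice Λ d)
    {u : Fin Λ.card → ℝ} (hu : u ∈ levelSumZero d) :
    ∃ e : Fin Λ.card → ℝ, ∀ i, ⁅H, ⁅diagonal e, H⁆⁆ i i = u i := by
  -- An endomorphism of a finite-dimensional space, so injectivity suffices.
  let M : levelSumZero d →ₗ[ℝ] levelSumZero d :=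
    { toFun := fun e => ⟨_, diag_lie_mem_levelSumZero hH.2.2 ⁅diagonal e.1, H⁆⟩
      map_add' := fun a b => by
        ext i
        change ⁅H, ⁅diagonal (a.1 + b.1), H⁆⁆ i i = (⁅H, ⁅diagonal a.1, H⁆⁆ + ⁅H, ⁅diagonal b.1, H⁆⁆) i i
        rw [show diagonal (a.1 + b.1) = diagonal a.1 + diagonal b.1 from (diagonal_add _ _).symm]
        refine congrFun (congrFun ?_ i) i
        simp only [Ring.lie_def, Matrix.add_mul, Matrix.mul_add, Matrix.mul_sub, Matrix.sub_mul]
        abel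
      map_smul' := fun c a => by
        ext i
        change ⁅H, ⁅diagonal (c • a.1), H⁆⁆ i i = (c • ⁅H, ⁅diagonal a.1, H⁆⁆) i i
        rw [diagonal_smul]
        simp [Ring.lie_def, mul_sub, ← smul_sub] }
  have hM : Function.Injective M := by
    rw [← LinearMap.ker_eq_bot, LinearMap.ker_eq_bot']
    intro e he
    have h0 : ∀ i, ⁅H, ⁅diagonal e.1, H⁆⁆ i i = 0 := fun i => congrFun (congrArg Subtype.val he) i
    -- Pairing `M e` with `e` gives `tr([Diag(e), H]²)`, so `M e = 0` forces the skew matrix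
    -- `[Diag(e), H]` to vanish.
    have h1 := sum_mul_diag_lie e.1 H ⁅diagonal e.1, H⁆
    simp only [h0, mul_zero, Finset.sum_const_zero] at h1
    have h2 := eq_zero_of_isSkew_of_trace
      (isSkew_lie_of_symm (diagonal_transpose e.1) hH.1.1) h1.symm
    exact Subtype.ext (eq_zero_of_mem_levelSumZero e.2 fun i j hij =>
      eq_of_diagonal_lie_eq_zero hΛ hH h2 hij)
  obtain ⟨e, he⟩ := LinearMap.injective_iff_surjective.1 hM ⟨u, hu⟩
  exact ⟨e.1, fun i => congrFun (congrArg Subtype.val he) i⟩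

end CritSlice

/-! ### Slice charts and tangent spaces of level sets -/

section Slice

variable {V W : Type*} [NormedAddCommGroup V] [NormedSpace ℝ V] [FiniteDimensional ℝ V]
  [NormedAddCommGroup W] [NormedSpace ℝ W] [FiniteDimensional ℝ W]

/-- The constant rank theorem for a level set: if `F` takes values in the range of its derivative
at `x`, then the zero set of `F` is straightened near `x` to the kernel of that derivative, by a
chart with derivative the identity. -/
theorem exists_slice_chart {F : V → W} {S : Set V} {x : V} {A : V →L[ℝ] W}
    (hF : ContDiff ℝ ∞ F) (hA : HasFDerivAt F A x) (hr : ∀ y, F y ∈ A.range)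
    (hS : ∀ᶠ y in 𝓝 x, y ∈ S ↔ F y = 0) :
    ∃ Φ : OpenPartialHomeomorph V V, x ∈ Φ.source ∧ ContDiffOn ℝ ∞ Φ Φ.source ∧
      ContDiffOn ℝ ∞ Φ.symm Φ.target ∧ (∀ y ∈ Φ.source, (y ∈ S ↔ Φ y ∈ A.ker)) ∧
      HasFDerivAt Φ (ContinuousLinearMap.id ℝ V) x := by
  obtain ⟨g, hg⟩ := (A : V →ₗ[ℝ] W).rangeRestrict.exists_rightInverse_of_surjective
    (LinearMap.range_rangeRestrict _)
  obtain ⟨R', hR'⟩ := LinearMap.exists_extend g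
  have hAR : ∀ w ∈ A.range, A (R' w) = w := fun w hw => by
    have h1 : R' w = g ⟨w, hw⟩ := LinearMap.congr_fun hR' ⟨w, hw⟩
    have h2 := congrArg Subtype.val (LinearMap.congr_fun hg ⟨w, hw⟩)
    rw [h1]
    exact h2
  let R : W →L[ℝ] V := LinearMap.toContinuousLinearMap R'
  -- With `R` a right inverse of `A` on its range, `A (φ y) = F y` holds for every `y`, so `φ`
  -- carries zeros of `F` into the kernel of `A`.
  let φ : V → V := fun y => y + R (F y - A y)
  have hφ : ContDiff ℝ ∞ φ := contDiff_id.add (R.contDiff.comp (hF.sub A.contDiff))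
  have hφ' : HasFDerivAt φ (ContinuousLinearMap.id ℝ V) x := by
    have := (hasFDerivAt_id x).add (R.hasFDerivAt.comp x (hA.sub A.hasFDerivAt))
    exact this.congr_fderiv (by simp)
  have hAφ : ∀ y, A (φ y) = F y := fun y => by
    have : A (R (F y - A y)) = F y - A y :=
      hAR _ (Submodule.sub_mem _ (hr y) (LinearMap.mem_range_self _ y))
    rw [map_add, this, add_sub_cancel]
  have hφe : HasFDerivAt φ ((ContinuousLinearEquiv.refl ℝ V : V ≃L[ℝ] V) : V →L[ℝ] V) x := hφ'
  obtain ⟨U, hUS, hUo, hxU⟩ := eventually_nhds_iff.1 hS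
  have hIo : IsOpen {y | IsUnit (fderiv ℝ φ y)} :=
    Units.isOpen.preimage (hφ.continuous_fderiv (by simp))
  let Ψ := (hφ.contDiffAt (x := x)).toOpenPartialHomeomorph φ hφe (by simp)
  -- The restriction secures invertibility of the derivative on the entire source, hence smoothness
  -- of the inverse on the entire target.
  let Φ := Ψ.restrOpen (U ∩ {y | IsUnit (fderiv ℝ φ y)}) (hUo.inter hIo)
  refine ⟨Φ, ?_, hφ.contDiffOn, ?_, ?_, hφ'⟩
  · refine ⟨ContDiffAt.mem_toOpenPartialHomeomorph_source _ _ _, hxU, ?_⟩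
    rw [Set.mem_ofPred_eq, hφ'.fderiv]
    exact isUnit_one
  · intro a ha
    have hs : Φ.symm a ∈ Φ.source := Φ.map_target ha
    obtain ⟨u, hu⟩ : IsUnit (fderiv ℝ φ (Φ.symm a)) := hs.2.2
    refine (Φ.contDiffAt_symm (f₀' := ContinuousLinearEquiv.unitsEquiv ℝ V u) ha ?_
      hφ.contDiffAt).contDiffWithinAt
    have h1 := (hφ.differentiable (by simp) (Φ.symm a)).hasFDerivAt
    rw [← hu] at h1
    exact h1
  · intro y hy
    rw [hUS y hy.2.1, LinearMap.mem_ker]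
    change F y = 0 ↔ A (φ y) = 0
    rw [hAφ]

/-- Differentiating `F ∘ γ = 0` gives one inclusion. For the other, the curve is the preimage of a
line in the kernel under the slice chart, whose derivative at `x` is the identity. -/
theorem tangentSpaceAt_eq_ker {F : V → W} {S : Set V} {x : V} {A : V →L[ℝ] W}
    (hF : ContDiff ℝ ∞ F) (hA : HasFDerivAt F A x) (hr : ∀ y, F y ∈ A.range)
    (hS : ∀ᶠ y in 𝓝 x, y ∈ S ↔ F y = 0) (hx : x ∈ S) :
    tangentSpaceAt S x = A.ker := by
  apply le_antisymm
  · refine Submodule.span_le.2 ?_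
    rintro v ⟨γ, hγ, h0, hγS, rfl⟩
    have hd : HasDerivAt γ (deriv γ 0) 0 := (hγ.differentiableAt (by simp)).hasDerivAt
    rw [← h0] at hA hS
    have h1 : HasDerivAt (F ∘ γ) (A (deriv γ 0)) 0 := hA.comp_hasDerivAt 0 hd
    have h2 : F ∘ γ =ᶠ[𝓝 0] fun _ => 0 := by
      filter_upwards [hγS, hγ.continuousAt.eventually hS] with t h3 h4
      exact h4.1 h3
    exact (h1.congr_of_eventuallyEq h2.symm).unique (hasDerivAt_const _ _)
  · intro v hv
    obtain ⟨Φ, hxs, -, hs, hΦ, hd⟩ := exists_slice_chart hF hA hr hS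
    refine Submodule.subset_span ⟨fun t => Φ.symm (Φ x + t • v), ?_, ?_, ?_, ?_⟩
    · refine ContDiffAt.comp (0 : ℝ) (g := Φ.symm) (f := fun t : ℝ => Φ x + t • v) ?_
        (by fun_prop)
      simp only [zero_smul, add_zero]
      exact hs.contDiffAt (Φ.open_target.mem_nhds (Φ.map_source hxs))
    · simp [Φ.left_inv hxs]
    · have hc : ContinuousAt (fun t : ℝ => Φ x + t • v) 0 := by fun_prop
      have ht : ∀ᶠ z in 𝓝 (Φ x + (0 : ℝ) • v), z ∈ Φ.target := by
        simp only [zero_smul, add_zero]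
        exact Φ.open_target.mem_nhds (Φ.map_source hxs)
      filter_upwards [hc.eventually ht] with t h
      rw [hΦ _ (Φ.map_target h), Φ.right_inv h]
      exact Submodule.add_mem _ ((hΦ x hxs).1 hx) (Submodule.smul_mem _ _ hv)
    · have h1 : HasFDerivAt Φ.symm (ContinuousLinearMap.id ℝ V) (Φ x) := by
        have := Φ.hasFDerivAt_symm (f' := ContinuousLinearEquiv.refl ℝ V)
          (Φ.map_source hxs) (by rw [Φ.left_inv hxs]; exact hd)
        exact this
      have h2 : HasDerivAt (fun t : ℝ => Φ x + t • v) v 0 := by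
        simpa using ((hasDerivAt_id (0 : ℝ)).smul_const v).const_add (Φ x)
      have h3 : Φ x = Φ x + (0 : ℝ) • v := by simp
      rw [h3] at h1
      exact (h1.comp_hasDerivAt 0 h2).deriv

end Slice

/-! ### Connected components of locally connected sets -/

section Components

/-- A set with slice charts is locally connected. -/
theorem exists_preconnected_of_slice_chart {V : Type*} [NormedAddCommGroup V] [NormedSpace ℝ V]
    {S : Set V} {x : V} (hx : x ∈ S)
    {Φ : OpenPartialHomeomorph V V} {L : Submodule ℝ V} (hxs : x ∈ Φ.source)
    (hΦ : ∀ y ∈ Φ.source, (y ∈ S ↔ Φ y ∈ L)) :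
    ∃ T ⊆ S, IsPreconnected T ∧ x ∈ T ∧ ∀ᶠ y in 𝓝 x, y ∈ S → y ∈ T := by
  obtain ⟨ε, hε, hb⟩ := Metric.isOpen_iff.1 Φ.open_target (Φ x) (Φ.map_source hxs)
  have hxL : Φ x ∈ L := (hΦ x hxs).1 hx
  -- A ball meets the subspace in a convex set, and its continuous image remains preconnected.
  refine ⟨Φ.symm '' (Metric.ball (Φ x) ε ∩ L), ?_, ?_, ?_, ?_⟩
  · rintro _ ⟨z, ⟨hz, hzL⟩, rfl⟩
    rw [hΦ _ (Φ.map_target (hb hz)), Φ.right_inv (hb hz)]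
    exact hzL
  · exact ((convex_ball _ _).inter L.convex).isPreconnected.image _
      (Φ.continuousOn_symm.mono fun z hz => hb hz.1)
  · exact ⟨Φ x, ⟨Metric.mem_ball_self hε, hxL⟩, Φ.left_inv hxs⟩
  · filter_upwards [Φ.open_source.mem_nhds hxs,
      (Φ.continuousAt hxs).eventually (Metric.ball_mem_nhds _ hε)] with y hy hyb hyS
    exact ⟨Φ y, ⟨hyb, (hΦ y hy).1 hyS⟩, Φ.left_inv hy⟩

variable {V : Type*} [TopologicalSpace V] {S : Set V}

/-- In a locally connected set the connected components are relatively open. -/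
theorem eventually_mem_connectedComponentIn_iff {x y : V} (hy : y ∈ connectedComponentIn S x)
    {T : Set V} (hTS : T ⊆ S) (hT : IsPreconnected T) (hyT : y ∈ T)
    (hev : ∀ᶠ z in 𝓝 y, z ∈ S → z ∈ T) :
    ∀ᶠ z in 𝓝 y, (z ∈ connectedComponentIn S x ↔ z ∈ S) := by
  rw [connectedComponentIn_eq hy]
  filter_upwards [hev] with z hz
  exact ⟨fun h => connectedComponentIn_subset _ _ h,
    fun h => hT.subset_connectedComponentIn hyT hTS (hz h)⟩

/-- A compact locally connected set has finitely many connected components. -/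
theorem finite_components_of_isCompact (hS : IsCompact S)
    (hloc : ∀ x ∈ S, ∃ T ⊆ S, IsPreconnected T ∧ x ∈ T ∧ ∀ᶠ y in 𝓝 x, y ∈ S → y ∈ T) :
    ((fun x => connectedComponentIn S x) '' S).Finite := by
  choose! T hTS hT hxT hev using hloc
  obtain ⟨t, ht, hcov⟩ := hS.elim_nhds_subcover (fun x => {y | y ∈ S → y ∈ T x}) hev
  refine (t.finite_toSet.image fun x => connectedComponentIn S x).subset ?_
  rintro _ ⟨y, hy, rfl⟩
  obtain ⟨x, hx, hyx⟩ := Set.mem_iUnion₂.1 (hcov hy)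
  refine ⟨x, hx, connectedComponentIn_eq ?_⟩
  exact (hT x (ht x hx)).subset_connectedComponentIn (hxT x (ht x hx)) (hTS x (ht x hx)) (hyx hy)

end Components

/-! ### Ingredients of the defining equations -/

section DefiningFunction

variable {n : ℕ}

/-- The part of a matrix that is symmetric and commutes with `Diag(d)`. -/
noncomputable def blockSymm (d : Fin n → ℝ) : Matrix (Fin n) (Fin n) ℝ →ₗ[ℝ] Matrix (Fin n) (Fin n) ℝ where
  toFun X := Matrix.of fun i j => if d i = d j then (X i j + X j i) / 2 else 0
  map_add' X Y := by
    ext i j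
    by_cases h : d i = d j <;> simp [h]
    ring
  map_smul' c X := by
    ext i j
    by_cases h : d i = d j <;> simp [h]
    ring

theorem blockSymm_apply (d : Fin n → ℝ) (X : Matrix (Fin n) (Fin n) ℝ) (i j : Fin n) :
    blockSymm d X i j = if d i = d j then (X i j + X j i) / 2 else 0 := rfl

theorem blockSymm_blockSymm (d : Fin n → ℝ) (X : Matrix (Fin n) (Fin n) ℝ) :
    blockSymm d (blockSymm d X) = blockSymm d X := by
  ext i j
  by_cases h : d i = d j
  · simp [blockSymm_apply, h]
    ring
  · simp [blockSymm_apply, h]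

theorem blockSymm_eq_self_iff {d : Fin n → ℝ} {X : Matrix (Fin n) (Fin n) ℝ} :
    blockSymm d X = X ↔ Xᵀ = X ∧ ⁅diagonal d, X⁆ = 0 := by
  rw [diagonal_lie_eq_zero_iff]
  refine ⟨fun h => ⟨?_, fun i j hij => ?_⟩, fun ⟨h1, h2⟩ => ?_⟩
  · rw [← h]
    ext i j
    simp only [transpose_apply, blockSymm_apply, eq_comm (a := d j), add_comm (X j i)]
  · rw [← h, blockSymm_apply, if_neg hij]
  · ext i j
    rw [blockSymm_apply]
    by_cases h : d i = d j
    · have : X j i = X i j := congrFun (congrFun h1 i) j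
      rw [if_pos h, this]
      ring
    · rw [if_neg h, h2 i j h]

/-- The graph Laplacian of the equivalence relation given by the level sets of `d`. -/
noncomputable def levelLaplacian (d : Fin n → ℝ) : (Fin n → ℝ) →ₗ[ℝ] (Fin n → ℝ) where
  toFun e i := ∑ j with d j = d i, (e i - e j)
  map_add' e f := by
    ext i
    simp only [Pi.add_apply, ← Finset.sum_add_distrib]
    exact Finset.sum_congr rfl fun j _ => by ring
  map_smul' c e := by
    ext i
    simp only [Pi.smul_apply, smul_eq_mul, RingHom.id_apply, Finset.mul_sum, mul_sub]

theorem levelLaplacian_apply (d e : Fin n → ℝ) (i : Fin n) :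
    levelLaplacian d e i = (Finset.univ.filter fun j => d j = d i).card * e i -
      ∑ j with d j = d i, e j := by
  simp [levelLaplacian]

theorem levelCard_ne_zero (d : Fin n → ℝ) (i : Fin n) :
    ((Finset.univ.filter fun j => d j = d i).card : ℝ) ≠ 0 := by
  exact_mod_cast (Finset.card_pos.2 ⟨i, by simp⟩).ne'

theorem levelLaplacian_mem (d e : Fin n → ℝ) : levelLaplacian d e ∈ levelSumZero d := by
  intro i
  have h : ∀ j ∈ Finset.univ.filter (fun j => d j = d i), levelLaplacian d e j =
      (Finset.univ.filter fun j => d j = d i).card * e j - ∑ j with d j = d i, e j := by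
    intro j hj
    rw [levelLaplacian_apply, (Finset.mem_filter.1 hj).2]
  rw [Finset.sum_congr rfl h, Finset.sum_sub_distrib, ← Finset.mul_sum]
  simp

theorem levelLaplacian_eq_zero_iff {d e : Fin n → ℝ} :
    levelLaplacian d e = 0 ↔ ∀ i j, d i = d j → e i = e j := by
  refine ⟨fun h i j hij => ?_, fun h => ?_⟩
  · have hi := congrFun h i
    have hj := congrFun h j
    rw [levelLaplacian_apply, Pi.zero_apply] at hi hj
    rw [hij] at hi
    exact mul_left_cancel₀ (levelCard_ne_zero d j) (by linarith)
  · ext i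
    change ∑ j with d j = d i, (e i - e j) = 0
    refine Finset.sum_eq_zero fun j hj => ?_
    rw [h j i (Finset.mem_filter.1 hj).2, sub_self]

/-- On vectors with zero level sums the Laplacian multiplies each entry by the size of its level
set. -/
theorem exists_levelLaplacian_eq {d u : Fin n → ℝ} (hu : u ∈ levelSumZero d) :
    ∃ e ∈ levelSumZero d, levelLaplacian d e = u := by
  have he : (fun i => u i / (Finset.univ.filter fun j => d j = d i).card) ∈ levelSumZero d := by
    intro i
    rw [Finset.sum_congr rfl (g := fun j => u j / (Finset.univ.filter fun j => d j = d i).card),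
      ← Finset.sum_div, mem_levelSumZero.1 hu i, zero_div]
    intro j hj
    simp only [(Finset.mem_filter.1 hj).2]
  refine ⟨_, he, ?_⟩
  ext i
  rw [levelLaplacian_apply, mem_levelSumZero.1 he i, sub_zero,
    mul_div_cancel₀ _ (levelCard_ne_zero d i)]

theorem contDiff_det : ContDiff ℝ ∞ (Matrix.det : Matrix (Fin n) (Fin n) ℝ → ℝ) := by
  have : (Matrix.det : Matrix (Fin n) (Fin n) ℝ → ℝ) =
      fun M => ∑ σ : Equiv.Perm (Fin n), Equiv.Perm.sign σ • ∏ i, M (σ i) i := by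
    ext M; exact Matrix.det_apply M
  rw [this]
  exact ContDiff.sum fun σ _ =>
    (contDiff_prod fun i _ => contDiff_entry (σ i) i).const_smul (Equiv.Perm.sign σ)

variable {Λ : Finset ℝ}

/-- The values at the elements of `Λ` of the characteristic polynomial. -/
noncomputable def charValues (Λ : Finset ℝ) (X : Mat Λ) : Fin Λ.card → ℝ :=
  fun i => (scalar (Fin Λ.card) (Λ.orderEmbOfFin rfl i) - X).det

theorem contDiff_charValues : ContDiff ℝ ∞ (charValues Λ) :=
  contDiff_pi.2 fun _ => contDiff_det.comp (contDiff_const.sub contDiff_id)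

theorem hasFDerivAt_charValues (H : Mat Λ) :
    HasFDerivAt (charValues Λ) (fderiv ℝ (charValues Λ) H) H :=
  (contDiff_charValues.differentiable (by simp) H).hasFDerivAt

theorem charValues_eq_zero {H : Mat Λ} (hH : H ∈ isoSym Λ) : charValues Λ H = 0 :=
  funext (mem_isoSym_iff_det.1 hH).2

variable {H : Mat Λ}

/-- `charValues` vanishes along the isospectral orbit curve. -/
theorem fderiv_charValues_lie (hH : H ∈ isoSym Λ) {Ω : Mat Λ} (hΩ : IsSkew Ω) :
    fderiv ℝ (charValues Λ) H ⁅H, Ω⁆ = 0 := by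
  have h := dirDeriv_eq_of_hasFDerivAt hH hΩ (hasFDerivAt_charValues H)
  rw [dirDeriv_congr (G := fun _ => 0) hH hΩ fun A hA => charValues_eq_zero hA] at h
  rw [← h]
  simp [dirDeriv]

theorem IsEigenframe.fderiv_charValues {Q : Mat Λ}
    (hQ : IsEigenframe H Q (Λ.orderEmbOfFin rfl)) (a : Fin Λ.card → ℝ) (i : Fin Λ.card) :
    fderiv ℝ (charValues Λ) H (Q * diagonal a * Qᵀ) i =
      -(a i * ∏ k ∈ Finset.univ.erase i,
        (Λ.orderEmbOfFin rfl i - Λ.orderEmbOfFin rfl k)) := by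
  set l := Λ.orderEmbOfFin rfl
  set X := Q * diagonal a * Qᵀ with hX
  -- `H + t X` keeps the eigenframe and has eigenvalues `l k + t a_k`; only the `i`-th factor of the
  -- determinant vanishes at `t = 0`.
  have hval : ∀ t : ℝ, charValues Λ (H + t • X) i =
      -(t * a i) * ∏ k ∈ Finset.univ.erase i, (l i - l k - t * a k) := fun t => by
    have e : scalar (Fin Λ.card) (l i) - (H + t • X) =
        Q * diagonal (fun k => l i - l k - t * a k) * Qᵀ := by
      have e1 : scalar (Fin Λ.card) (l i) = Q * scalar (Fin Λ.card) (l i) * Qᵀ := by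
        rw [← (Matrix.scalar_commute (l i) (fun _ => mul_comm _ _) Q).eq, Matrix.mul_assoc,
          hQ.orth', Matrix.mul_one]
      rw [e1, hX, hQ.eq_conj hQ.mul_eq, ← Matrix.smul_mul, ← Matrix.mul_smul, ← Matrix.add_mul,
        ← Matrix.sub_mul, ← Matrix.mul_add, ← Matrix.mul_sub]
      congr 2
      ext p q
      by_cases hpq : p = q
      · subst hpq; simp; ring
      · simp [hpq]
    rw [charValues, e, det_mul, det_mul, mul_right_comm, ← det_mul, hQ.orth', det_one, one_mul,
      det_diagonal, ← Finset.mul_prod_erase _ _ (Finset.mem_univ i)]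
    ring
  have h1 : HasDerivAt (fun t : ℝ => H + t • X) X 0 := by
    exact (((hasDerivAt_id (0 : ℝ)).smul_const X).const_add H).congr_deriv (one_smul ℝ X)
  have h2 := hasFDerivAt_charValues H
  rw [show H = H + (0 : ℝ) • X by simp] at h2
  have h3 := hasDerivAt_pi.1 (h2.comp_hasDerivAt (0 : ℝ) h1) i
  rw [show H + (0 : ℝ) • X = H by simp] at h3
  have h4 : HasDerivAt (fun t : ℝ => ∏ k ∈ Finset.univ.erase i, (l i - l k - t * a k))
      (deriv (fun t : ℝ => ∏ k ∈ Finset.univ.erase i, (l i - l k - t * a k)) 0) 0 :=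
    DifferentiableAt.hasDerivAt (by fun_prop)
  have h5 := (((hasDerivAt_id (0 : ℝ)).mul_const (a i)).neg).mul h4
  have h6 := h3.unique (h5.congr_of_eventuallyEq (Filter.Eventually.of_forall hval))
  refine h6.trans ?_
  simp

end DefiningFunction

/-! ### Critical slices as submanifolds -/

section CritChart

variable {Λ : Finset ℝ}

/-- The linear map sending a matrix to its diagonal. -/
def diagLin (n : ℕ) : Matrix (Fin n) (Fin n) ℝ →ₗ[ℝ] (Fin n → ℝ) := Matrix.diagLinearMap (Fin n) ℝ ℝ

theorem diagLin_apply {n : ℕ} (X : Matrix (Fin n) (Fin n) ℝ) (i : Fin n) : diagLin n X i = X i i :=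
  rfl

/-- A function whose zero set is `critSlice Λ d` near each of its points. -/
noncomputable def critFun (d : Fin Λ.card → ℝ) (X : Mat Λ) :
    Mat Λ × (Fin Λ.card → ℝ) × (Fin Λ.card → ℝ) :=
  (X - blockSymm d X, charValues Λ X, levelLaplacian d (diagLin _ X - d))

/-- The derivative of `critFun`. -/
noncomputable def critFunDeriv (d : Fin Λ.card → ℝ) (H : Mat Λ) :
    Mat Λ →L[ℝ] Mat Λ × (Fin Λ.card → ℝ) × (Fin Λ.card → ℝ) :=
  (LinearMap.toContinuousLinearMap (LinearMap.id - blockSymm d)).prod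
    ((fderiv ℝ (charValues Λ) H).prod
      (LinearMap.toContinuousLinearMap (levelLaplacian d ∘ₗ diagLin _)))

theorem critFunDeriv_apply (d : Fin Λ.card → ℝ) (H X : Mat Λ) :
    critFunDeriv d H X =
      (X - blockSymm d X, fderiv ℝ (charValues Λ) H X, levelLaplacian d (diagLin _ X)) := rfl

theorem contDiff_critFun (d : Fin Λ.card → ℝ) : ContDiff ℝ ∞ (critFun d) := by
  refine ContDiff.prodMk ?_ (contDiff_charValues.prodMk ?_)
  · exact (LinearMap.toContinuousLinearMap (LinearMap.id - blockSymm d)).contDiff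
  · exact (LinearMap.toContinuousLinearMap (levelLaplacian d)).contDiff.comp
      ((LinearMap.toContinuousLinearMap (diagLin _)).contDiff.sub contDiff_const)

theorem hasFDerivAt_critFun (d : Fin Λ.card → ℝ) (H : Mat Λ) :
    HasFDerivAt (critFun d) (critFunDeriv d H) H := by
  refine HasFDerivAt.prodMk ?_ ((hasFDerivAt_charValues H).prodMk ?_)
  · exact (LinearMap.toContinuousLinearMap (LinearMap.id - blockSymm d)).hasFDerivAt
  · exact (LinearMap.toContinuousLinearMap (levelLaplacian d)).hasFDerivAt.comp H
      ((LinearMap.toContinuousLinearMap (diagLin _)).hasFDerivAt.sub_const d)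

/-- The range of the derivative of `critFun` at a critical point. -/
noncomputable def critRange (d : Fin Λ.card → ℝ) :
    Submodule ℝ (Mat Λ × (Fin Λ.card → ℝ) × (Fin Λ.card → ℝ)) :=
  (blockSymm d).ker.prod ((⊤ : Submodule ℝ (Fin Λ.card → ℝ)).prod (levelSumZero d))

theorem critFun_mem (d : Fin Λ.card → ℝ) (X : Mat Λ) : critFun d X ∈ critRange d :=
  ⟨by simp [critFun, blockSymm_blockSymm], trivial, levelLaplacian_mem _ _⟩

variable {d : Fin Λ.card → ℝ} {H : Mat Λ}

theorem lie_mem_block {n : ℕ} {d : Fin n → ℝ} {H Ω : Matrix (Fin n) (Fin n) ℝ}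
    (hH : ⁅diagonal d, H⁆ = 0) (hΩ : ⁅diagonal d, Ω⁆ = 0) : ⁅diagonal d, ⁅H, Ω⁆⁆ = 0 := by
  have e : ⁅diagonal d, ⁅H, Ω⁆⁆ = ⁅⁅diagonal d, H⁆, Ω⁆ + ⁅H, ⁅diagonal d, Ω⁆⁆ := by
    simp only [Ring.lie_def]
    noncomm_ring
  rw [e, hH, hΩ]
  simp [Ring.lie_def]

theorem diagonal_lie_lie {n : ℕ} {d : Fin n → ℝ} {H : Matrix (Fin n) (Fin n) ℝ}
    (hH : ⁅diagonal d, H⁆ = 0) (e : Fin n → ℝ) : ⁅diagonal d, ⁅diagonal e, H⁆⁆ = 0 := by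
  rw [diagonal_lie_eq_zero_iff] at hH ⊢
  intro i j hij
  rw [diagonal_lie_apply, hH i j hij, mul_zero]

/-- The three components are prescribed independently: `S` handles the first, a motion of the
eigenvalues of `H` the second, and a vector `[H, [Diag(f), H]]` the third without disturbing the
others. The Laplacian removes the level sums of the diagonal, which are traces of blocks and so are
governed by the eigenvalues. -/
theorem range_critFunDeriv (hΛ : StronglyDisjoint Λ) (hH : H ∈ critSlice Λ d) :
    (critFunDeriv d H).range = critRange d := by
  apply le_antisymm
  · rintro _ ⟨X, rfl⟩
    exact ⟨by simp [critFunDeriv, blockSymm_blockSymm], trivial, levelLaplacian_mem _ _⟩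
  · rintro ⟨S, c, u⟩ ⟨hS, -, hu⟩
    simp only [SetLike.mem_coe, LinearMap.mem_ker] at hS
    obtain ⟨Q, hQ⟩ := exists_isEigenframe hH.1
    obtain ⟨m, hm⟩ := hQ.exists_mul_eq_of_commute hH.2.2
    set l := Λ.orderEmbOfFin rfl with hl
    have hne : ∀ i, ∏ k ∈ Finset.univ.erase i, (l i - l k) ≠ 0 := fun i =>
      Finset.prod_ne_zero_iff.2 fun k hk =>
        sub_ne_zero.2 fun e => (Finset.mem_erase.1 hk).1 (hQ.inj e).symm
    -- These are the eigenvalue velocities obtained by inverting `IsEigenframe.fderiv_charValues`,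
    -- after subtracting the contribution of `S`.
    let a : Fin Λ.card → ℝ := fun i => -((c - fderiv ℝ (charValues Λ) H S) i /
      ∏ k ∈ Finset.univ.erase i, (l i - l k))
    set X := Q * diagonal a * Qᵀ with hX
    have hX1 : blockSymm d X = X := by
      refine blockSymm_eq_self_iff.2 ⟨by simp [hX, Matrix.mul_assoc], ?_⟩
      apply hQ.ext_coord
      ext i j
      rw [hQ.coord_lie hm, hX, hQ.coord_of]
      by_cases h : i = j <;> simp [h]
    have hX2 : fderiv ℝ (charValues Λ) H X = c - fderiv ℝ (charValues Λ) H S := by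
      ext i
      refine (hQ.fderiv_charValues a i).trans ?_
      rw [← neg_mul, neg_neg, div_mul_cancel₀ _ (hne i)]
    obtain ⟨e, heZ, he⟩ := exists_levelLaplacian_eq
      ((levelSumZero d).sub_mem hu (levelLaplacian_mem d (diagLin _ (S + X))))
    obtain ⟨f, hf⟩ := exists_diag_lie_eq hΛ hH heZ
    have hsk := isSkew_lie_of_symm (diagonal_transpose f) hH.1.1
    have hY1 : blockSymm d ⁅H, ⁅diagonal f, H⁆⁆ = ⁅H, ⁅diagonal f, H⁆⁆ :=
      blockSymm_eq_self_iff.2 ⟨lie_transpose_of_skew hH.1.1 hsk,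
        lie_mem_block hH.2.2 (diagonal_lie_lie hH.2.2 f)⟩
    have hY2 := fderiv_charValues_lie hH.1 hsk
    have hY3 : diagLin _ ⁅H, ⁅diagonal f, H⁆⁆ = e := funext hf
    refine ⟨S + X + ⁅H, ⁅diagonal f, H⁆⁆, ?_⟩
    change critFunDeriv d H _ = _
    rw [map_add, map_add, critFunDeriv_apply, critFunDeriv_apply, critFunDeriv_apply, hX1, hX2,
      hY1, hY2, hY3, hS, he, map_add, map_add]
    simp

/-- The tangent vectors at `H` that commute with `Diag(d)` and have zero diagonal. -/
def critTangent (d : Fin Λ.card → ℝ) (H : Mat Λ) : Set (Mat Λ) :=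
  {X | X ∈ isoTangent H ∧ ⁅diagonal d, X⁆ = 0 ∧ ∀ i, X i i = 0}

/-- The derivative of `charValues` detects exactly the frame diagonal of a symmetric matrix, so its
kernel there is the tangent space. The diagonal of a tangent vector commuting with `Diag(d)` has
zero level sums, so it vanishes once constant on levels. -/
theorem ker_critFunDeriv (hH : H ∈ critSlice Λ d) :
    ((critFunDeriv d H).ker : Set (Mat Λ)) = critTangent d H := by
  obtain ⟨Q, hQ⟩ := exists_isEigenframe hH.1
  ext X
  have hk : X ∈ ((critFunDeriv d H).ker : Set (Mat Λ)) ↔ blockSymm d X = X ∧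
      fderiv ℝ (charValues Λ) H X = 0 ∧ levelLaplacian d (diagLin _ X) = 0 := by
    rw [SetLike.mem_coe, LinearMap.mem_ker]
    change critFunDeriv d H X = 0 ↔ _
    rw [critFunDeriv_apply, Prod.mk_eq_zero, Prod.mk_eq_zero, sub_eq_zero, eq_comm (a := X)]
  rw [hk, blockSymm_eq_self_iff]
  constructor
  · rintro ⟨⟨h1, h2⟩, h3, h4⟩
    have ht : X ∈ isoTangent H := by
      set X₀ := Q * diagonal (fun i => (Qᵀ * X * Q) i i) * Qᵀ with hX₀
      have hs : X₀ᵀ = X₀ := by simp [hX₀, Matrix.mul_assoc]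
      obtain ⟨Ω, hΩ, e⟩ := hQ.mem_isoTangent (X := X - X₀) (by rw [transpose_sub, h1, hs])
        fun i => by
          rw [Matrix.mul_sub, Matrix.sub_mul, hX₀, hQ.coord_of]
          simp
      have h5 := fderiv_charValues_lie hH.1 hΩ
      rw [e, map_sub, h3, zero_sub, neg_eq_zero] at h5
      refine hQ.mem_isoTangent h1 fun i => ?_
      have h6 := (hQ.fderiv_charValues (fun i => (Qᵀ * X * Q) i i) i).symm.trans (congrFun h5 i)
      rw [Pi.zero_apply, neg_eq_zero] at h6
      refine (mul_eq_zero.1 h6).resolve_right (Finset.prod_ne_zero_iff.2 fun k hk => ?_)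
      exact sub_ne_zero.2 fun e => (Finset.mem_erase.1 hk).1 (hQ.inj e).symm
    refine ⟨ht, h2, ?_⟩
    obtain ⟨Ω, hΩ, rfl⟩ := ht
    exact congrFun (eq_zero_of_mem_levelSumZero (diag_lie_mem_levelSumZero hH.2.2 Ω)
      (levelLaplacian_eq_zero_iff.1 h4))
  · rintro ⟨⟨Ω, hΩ, rfl⟩, h2, h3⟩
    refine ⟨⟨lie_transpose_of_skew hH.1.1 hΩ, h2⟩, fderiv_charValues_lie hH.1 hΩ, ?_⟩
    rw [show diagLin _ ⁅H, Ω⁆ = 0 from funext h3, map_zero]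

theorem continuous_matrix_entry {n : ℕ} (i j : Fin n) :
    Continuous fun A : Matrix (Fin n) (Fin n) ℝ => A i j :=
  (LinearMap.toContinuousLinearMap (Matrix.entryLinearMap ℝ ℝ i j)).continuous

/-- A zero of `critFun d` need only have a diagonal differing from `d` by a constant on each level
set. Its entries are still means of subsets of `Λ`, a finite set, so near `H` they equal those of
`d`. -/
theorem eventually_mem_critSlice_iff (hH : H ∈ critSlice Λ d) :
    ∀ᶠ X in 𝓝 H, X ∈ critSlice Λ d ↔ critFun d X = 0 := by
  have hev : ∀ i, ∀ᶠ X : Mat Λ in 𝓝 H, X i i ∉ ((Λ.powerset.image mean).erase (d i) : Finset ℝ) := by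
    intro i
    refine ((continuous_matrix_entry i i).isOpen_preimage _
      ((Λ.powerset.image mean).erase (d i)).finite_toSet.isClosed.isOpen_compl).mem_nhds ?_
    simp [hH.2.1 i]
  filter_upwards [Filter.eventually_all.2 hev] with X hX
  rw [critFun, Prod.mk_eq_zero, Prod.mk_eq_zero, sub_eq_zero, eq_comm (a := X),
    blockSymm_eq_self_iff, levelLaplacian_eq_zero_iff]
  constructor
  · rintro ⟨h1, h2, h3⟩
    refine ⟨⟨h1.1, h3⟩, charValues_eq_zero h1, fun i j _ => ?_⟩
    simp [diagLin_apply, h2]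
  · rintro ⟨⟨h1, h2⟩, h3, h4⟩
    have hiso : X ∈ isoSym Λ := mem_isoSym_iff_det.2 ⟨h1, congrFun h3⟩
    have hcrit : X ∈ critSlice Λ fun i => X i i := by
      refine ⟨hiso, fun i => rfl, diagonal_lie_eq_zero_iff.2 fun i j hij => ?_⟩
      refine diagonal_lie_eq_zero_iff.1 h2 i j fun e => hij ?_
      have := h4 i j e
      rw [Pi.sub_apply, Pi.sub_apply, e, sub_left_inj] at this
      exact this
    refine ⟨hiso, fun i => ?_, h2⟩
    by_contra hne
    exact hX i (Finset.mem_erase.2 ⟨hne, mem_image_mean_of_mem_critSlice hcrit i⟩)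

theorem eventually_iff_critFun (hH : H ∈ critSlice Λ d) {S : Set (Mat Λ)}
    (hS : ∀ᶠ X in 𝓝 H, X ∈ S ↔ X ∈ critSlice Λ d) :
    ∀ᶠ X in 𝓝 H, X ∈ S ↔ critFun d X = 0 := by
  filter_upwards [hS, eventually_mem_critSlice_iff hH] with X h1 h2
  rw [h1, h2]

theorem coe_tangentSpaceAt_eq (hΛ : StronglyDisjoint Λ) (hH : H ∈ critSlice Λ d) {S : Set (Mat Λ)}
    (hS : ∀ᶠ X in 𝓝 H, X ∈ S ↔ X ∈ critSlice Λ d) :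
    (tangentSpaceAt S H : Set (Mat Λ)) = critTangent d H := by
  rw [← ker_critFunDeriv hH]
  refine congrArg _ (tangentSpaceAt_eq_ker (contDiff_critFun d) (hasFDerivAt_critFun d H) ?_
    (eventually_iff_critFun hH hS) (hS.self_of_nhds.2 hH))
  rw [range_critFunDeriv hΛ hH]
  exact critFun_mem d

/-- The range of the derivative depends only on `d`, so the dimension is the same at all points of
the slice. -/
theorem exists_critSlice_chart (hΛ : StronglyDisjoint Λ) (hH : H ∈ critSlice Λ d) {S : Set (Mat Λ)}
    (hS : ∀ᶠ X in 𝓝 H, X ∈ S ↔ X ∈ critSlice Λ d) :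
    ∃ (Φ : OpenPartialHomeomorph (Mat Λ) (Mat Λ)) (L : Submodule ℝ (Mat Λ)),
      H ∈ Φ.source ∧ ContDiffOn ℝ ∞ Φ Φ.source ∧ ContDiffOn ℝ ∞ Φ.symm Φ.target ∧
      Module.finrank ℝ L = Module.finrank ℝ (Mat Λ) - Module.finrank ℝ (critRange d) ∧
      ∀ y ∈ Φ.source, (y ∈ S ↔ Φ y ∈ L) := by
  obtain ⟨Φ, h1, h2, h3, h4, -⟩ := exists_slice_chart (contDiff_critFun d)
    (hasFDerivAt_critFun d H) (by rw [range_critFunDeriv hΛ hH]; exact critFun_mem d)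
    (eventually_iff_critFun hH hS)
  refine ⟨Φ, _, h1, h2, h3, ?_, h4⟩
  have := LinearMap.finrank_range_add_finrank_ker (critFunDeriv d H).toLinearMap
  rw [← range_critFunDeriv hΛ hH]
  exact Nat.eq_sub_of_add_eq' this

end CritChart

/-! ### The Hessian on the normal space of a slice -/

section CritHessian

variable {Λ : Finset ℝ} {d : Fin Λ.card → ℝ} {H : Mat Λ}

/-- At a critical point the Hessian is `⟨diag X, diag Y⟩ + tr([Diag(d), X] Ω)`, `Y = [H, Ω]`. -/
theorem hessian_eq_of_mem_critSlice (hH : H ∈ critSlice Λ d) {Ω₁ Ω₂ : Mat Λ} (h₁ : IsSkew Ω₁)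
    (h₂ : IsSkew Ω₂) :
    hessian diagPotential H ⁅H, Ω₁⁆ ⁅H, Ω₂⁆ =
      ∑ i, ⁅H, Ω₁⁆ i i * ⁅H, Ω₂⁆ i i + (⁅diagonal d, ⁅H, Ω₁⁆⁆ * Ω₂).trace := by
  rw [hessian_lie hH.1 h₁ h₂]
  simp only [hH.2.1]
  rw [sum_mul_diag_lie d H, hH.2.2, Matrix.zero_mul, trace_zero, sub_zero,
    sum_mul_diag_lie d ⁅H, Ω₁⁆]

/-- The difference of the two sides is, by the Jacobi identity, the derivative of the potential
along `[H, [Ω₁, Ω₂]]`, which is zero at a critical point. -/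
theorem hessian_comm (hH : H ∈ critSlice Λ d) {X Y : Mat Λ} (hX : X ∈ isoTangent H)
    (hY : Y ∈ isoTangent H) :
    hessian diagPotential H X Y = hessian diagPotential H Y X := by
  obtain ⟨Ω₁, h₁, rfl⟩ := hX
  obtain ⟨Ω₂, h₂, rfl⟩ := hY
  rw [hessian_eq_of_mem_critSlice hH h₁ h₂, hessian_eq_of_mem_critSlice hH h₂ h₁,
    ← sum_mul_diag_lie, ← sum_mul_diag_lie]
  have e := sum_mul_diag_lie d H ⁅Ω₁, Ω₂⁆
  rw [hH.2.2, Matrix.zero_mul, trace_zero] at e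
  have j : ⁅H, ⁅Ω₁, Ω₂⁆⁆ = ⁅⁅H, Ω₁⁆, Ω₂⁆ - ⁅⁅H, Ω₂⁆, Ω₁⁆ := by
    simp only [Ring.lie_def]
    noncomm_ring
  rw [j] at e
  simp only [Matrix.sub_apply, mul_sub, Finset.sum_sub_distrib] at e
  simp only [mul_comm (⁅H, Ω₁⁆ _ _)]
  linarith

theorem isoTangent_add {X Y : Mat Λ} (hX : X ∈ isoTangent H) (hY : Y ∈ isoTangent H) :
    X + Y ∈ isoTangent H := by
  obtain ⟨Ω₁, h₁, rfl⟩ := hX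
  obtain ⟨Ω₂, h₂, rfl⟩ := hY
  refine ⟨_, h₁.add h₂, ?_⟩
  simp only [Ring.lie_def]
  noncomm_ring

theorem isoTangent_smul (c : ℝ) {X : Mat Λ} (hX : X ∈ isoTangent H) : c • X ∈ isoTangent H := by
  obtain ⟨Ω, h, rfl⟩ := hX
  exact ⟨_, h.smul c, by simp [Ring.lie_def, smul_sub]⟩

theorem hessian_add_left (hH : H ∈ critSlice Λ d) {X Y Z : Mat Λ} (hX : X ∈ isoTangent H)
    (hY : Y ∈ isoTangent H) (hZ : Z ∈ isoTangent H) :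
    hessian diagPotential H (X + Y) Z =
      hessian diagPotential H X Z + hessian diagPotential H Y Z := by
  obtain ⟨Ω, hΩ, e⟩ := isoTangent_add hX hY
  obtain ⟨Ω₁, h₁, rfl⟩ := hX
  obtain ⟨Ω₂, h₂, rfl⟩ := hY
  obtain ⟨Ω₃, h₃, rfl⟩ := hZ
  rw [← e, hessian_eq_of_mem_critSlice hH hΩ h₃, hessian_eq_of_mem_critSlice hH h₁ h₃,
    hessian_eq_of_mem_critSlice hH h₂ h₃, e, show ⁅diagonal d, ⁅H, Ω₁⁆ + ⁅H, Ω₂⁆⁆ =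
      ⁅diagonal d, ⁅H, Ω₁⁆⁆ + ⁅diagonal d, ⁅H, Ω₂⁆⁆ by simp only [Ring.lie_def]; noncomm_ring,
    Matrix.add_mul, trace_add]
  simp only [Matrix.add_apply, add_mul, Finset.sum_add_distrib]
  ring

theorem hessian_smul_left (hH : H ∈ critSlice Λ d) (c : ℝ) {X Z : Mat Λ} (hX : X ∈ isoTangent H)
    (hZ : Z ∈ isoTangent H) :
    hessian diagPotential H (c • X) Z = c * hessian diagPotential H X Z := by
  obtain ⟨Ω, hΩ, e⟩ := isoTangent_smul c hX
  obtain ⟨Ω₁, h₁, rfl⟩ := hX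
  obtain ⟨Ω₃, h₃, rfl⟩ := hZ
  rw [← e, hessian_eq_of_mem_critSlice hH hΩ h₃, hessian_eq_of_mem_critSlice hH h₁ h₃, e,
    show ⁅diagonal d, c • ⁅H, Ω₁⁆⁆ = c • ⁅diagonal d, ⁅H, Ω₁⁆⁆ by
      simp only [Ring.lie_def, ← smul_sub, mul_smul_comm, smul_mul_assoc],
    Matrix.smul_mul, trace_smul, smul_eq_mul, mul_add, Finset.mul_sum]
  simp only [Matrix.smul_apply, smul_eq_mul, mul_assoc]

/-- The orthogonal complement of the critical tangent space. -/
def critNormal (d : Fin Λ.card → ℝ) (H : Mat Λ) : Set (Mat Λ) :=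
  {X | X ∈ isoTangent H ∧ ∀ Y ∈ critTangent d H, normalMetric H X Y = 0}

theorem normalSpace_eq_critNormal (hΛ : StronglyDisjoint Λ) (hH : H ∈ critSlice Λ d)
    {S : Set (Mat Λ)} (hS : ∀ᶠ X in 𝓝 H, X ∈ S ↔ X ∈ critSlice Λ d) :
    normalSpace S H = critNormal d H := by
  simp only [normalSpace, critNormal, ← SetLike.mem_coe, coe_tangentSpaceAt_eq hΛ hH hS]

/-- Such an `X` is tangent as well as normal, and the metric is definite. -/
theorem eq_zero_of_mem_critNormal (hH : H ∈ critSlice Λ d) {X : Mat Λ} (hX : X ∈ critNormal d H)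
    (hd : ⁅diagonal d, X⁆ = 0) (h0 : ∀ i, X i i = 0) : X = 0 := by
  have h := hX.2 X ⟨hX.1, hd, h0⟩
  obtain ⟨Ω, hΩ, rfl⟩ := hX.1
  rw [normalMetric_lie hH.1 hΩ hΩ, neg_eq_zero] at h
  rw [eq_zero_of_isSkew_of_trace hΩ h]
  simp [Ring.lie_def]

/-- The skew symmetric matrix `u vᵀ - v uᵀ`. -/
def wedge {n : ℕ} (u v : Fin n → ℝ) : Matrix (Fin n) (Fin n) ℝ := vecMulVec u v - vecMulVec v u

theorem isSkew_wedge {n : ℕ} (u v : Fin n → ℝ) : IsSkew (wedge u v) := by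
  rw [IsSkew, wedge, transpose_sub, transpose_vecMulVec, transpose_vecMulVec, neg_sub]

theorem trace_mul_wedge {n : ℕ} (A : Matrix (Fin n) (Fin n) ℝ) (u v : Fin n → ℝ) :
    (A * wedge u v).trace = v ⬝ᵥ (A *ᵥ u) - u ⬝ᵥ (A *ᵥ v) := by
  rw [wedge, Matrix.mul_sub, trace_sub, mul_vecMulVec, mul_vecMulVec, trace_vecMulVec,
    trace_vecMulVec, dotProduct_comm, dotProduct_comm (A *ᵥ v)]

theorem coord_eq {n : ℕ} {ι : Type*} (Q : Matrix (Fin n) ι ℝ) (A : Matrix (Fin n) (Fin n) ℝ)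
    (i j : ι) : (Qᵀ * A * Q) i j = Qᵀ i ⬝ᵥ (A *ᵥ Qᵀ j) := by
  rw [Matrix.mul_assoc, Matrix.mul_apply]
  rfl

theorem coord_symm {n : ℕ} {ι : Type*} {Q : Matrix (Fin n) ι ℝ} {X : Matrix (Fin n) (Fin n) ℝ}
    (hX : Xᵀ = X) (i j : ι) : (Qᵀ * X * Q) j i = (Qᵀ * X * Q) i j := by
  have : (Qᵀ * X * Q)ᵀ = Qᵀ * X * Q := by
    rw [Matrix.transpose_mul, Matrix.transpose_mul, transpose_transpose, hX, Matrix.mul_assoc]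
  exact congrFun (congrFun this i) j

theorem mulVec_eq_of_mul_eq {n : ℕ} {ι : Type*} [Fintype ι] [DecidableEq ι]
    {Q : Matrix (Fin n) ι ℝ} {A : Matrix (Fin n) (Fin n) ℝ} {a : ι → ℝ}
    (hA : A * Q = Q * diagonal a) (i : ι) : A *ᵥ Qᵀ i = a i • Qᵀ i := by
  ext x
  have := congrFun (congrFun hA x) i
  rw [mul_diagonal, mul_comm] at this
  exact this

theorem lie_wedge {n : ℕ} {A : Matrix (Fin n) (Fin n) ℝ} (hA : Aᵀ = A) {u v : Fin n → ℝ} {a b : ℝ}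
    (hu : A *ᵥ u = a • u) (hv : A *ᵥ v = b • v) :
    ⁅A, wedge u v⁆ = (a - b) • (vecMulVec u v + vecMulVec v u) := by
  rw [Ring.lie_def, wedge, Matrix.mul_sub, Matrix.sub_mul, mul_vecMulVec, mul_vecMulVec,
    vecMulVec_mul, vecMulVec_mul, ← mulVec_transpose, ← mulVec_transpose, hA, hu, hv,
    smul_vecMulVec, smul_vecMulVec, vecMulVec_smul, vecMulVec_smul]
  module

namespace IsEigenframe

variable {ι : Type*} [Fintype ι] [DecidableEq ι] {Q : Matrix (Fin Λ.card) ι ℝ} {l m : ι → ℝ}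

/-- Eigenvectors of `Diag(d)` for distinct eigenvalues have disjoint supports. -/
theorem mul_eq_zero_of_ne (hm : diagonal d * Q = Q * diagonal m) {i j : ι}
    (hij : m i ≠ m j) (x : Fin Λ.card) : Qᵀ i x * Qᵀ j x = 0 := by
  have hi := congrFun (mulVec_eq_of_mul_eq hm i) x
  have hj := congrFun (mulVec_eq_of_mul_eq hm j) x
  rw [mulVec_diagonal, Pi.smul_apply, smul_eq_mul] at hi hj
  have : (m i - m j) * (Qᵀ i x * Qᵀ j x) = 0 := by
    linear_combination Qᵀ i x * hj - Qᵀ j x * hi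
  exact (mul_eq_zero.1 this).resolve_left (sub_ne_zero.2 hij)

theorem lie_wedge_diag (h : IsEigenframe H Q l) (hm : diagonal d * Q = Q * diagonal m) {i j : ι}
    (hij : m i ≠ m j) (x : Fin Λ.card) : ⁅H, wedge (Qᵀ i) (Qᵀ j)⁆ x x = 0 := by
  rw [lie_wedge h.symm (mulVec_eq_of_mul_eq h.mul_eq i) (mulVec_eq_of_mul_eq h.mul_eq j)]
  simp only [Matrix.smul_apply, Matrix.add_apply, vecMulVec_apply, smul_eq_mul]
  rw [mul_eq_zero_of_ne hm hij, mul_comm (Qᵀ j x), mul_eq_zero_of_ne hm hij]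
  simp

/-- The diagonal term drops because the two eigenvectors have disjoint supports; the trace against a
wedge reads off one coordinate of `[Diag(d), X]` and its transpose, whence the factor `2`. -/
theorem hessian_wedge (h : IsEigenframe H Q l) (hm : diagonal d * Q = Q * diagonal m)
    (hH : H ∈ critSlice Λ d) {X : Mat Λ} (hX : X ∈ isoTangent H) {i j : ι} (hij : m i ≠ m j) :
    hessian diagPotential H X ⁅H, wedge (Qᵀ i) (Qᵀ j)⁆ =
      -2 * (m i - m j) * (Qᵀ * X * Q) i j := by
  obtain ⟨Ω, hΩ, rfl⟩ := hX
  rw [hessian_eq_of_mem_critSlice hH hΩ (isSkew_wedge _ _), trace_mul_wedge, ← coord_eq,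
    ← coord_eq, h.coord_lie hm, h.coord_lie hm,
    coord_symm (lie_transpose_of_skew hH.1.1 hΩ)]
  simp only [h.lie_wedge_diag hm hij, mul_zero, Finset.sum_const_zero]
  ring

/-- If `[H, Ω]` commutes with `Diag(d)`, then `Ω` has no frame coordinates between different
eigenvalues of `Diag(d)`, and pairing with the wedge sees only such coordinates. -/
theorem wedge_mem_critNormal (h : IsEigenframe H Q l) (hm : diagonal d * Q = Q * diagonal m)
    (hH : H ∈ critSlice Λ d) {i j : ι} (hij : m i ≠ m j) :
    ⁅H, wedge (Qᵀ i) (Qᵀ j)⁆ ∈ critNormal d H := by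
  refine ⟨⟨_, isSkew_wedge _ _, rfl⟩, ?_⟩
  rintro _ ⟨⟨Ω, hΩ, rfl⟩, h1, -⟩
  have key : ∀ {a b : ι}, m a ≠ m b → (Qᵀ * Ω * Q) a b = 0 := fun {a b} hab => by
    have e := h.coord_lie hm ⁅H, Ω⁆ a b
    rw [h1, h.coord_lie h.mul_eq] at e
    simp only [Matrix.mul_zero, Matrix.zero_mul, Matrix.zero_apply, zero_eq_mul, sub_eq_zero] at e
    exact (mul_eq_zero.1 (e.resolve_left hab)).resolve_left fun e' => hab (congrArg m (h.inj (sub_eq_zero.1 e')))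
  rw [normalMetric_lie hH.1 (isSkew_wedge _ _) hΩ, Matrix.trace_mul_comm, trace_mul_wedge,
    ← coord_eq, ← coord_eq, key hij, key hij.symm, sub_zero, neg_zero]

theorem coord_eq_zero_of_hessian (h : IsEigenframe H Q l) (hm : diagonal d * Q = Q * diagonal m)
    (hH : H ∈ critSlice Λ d) {X : Mat Λ} (hX : X ∈ isoTangent H) {i j : ι} (hij : m i ≠ m j)
    (h0 : hessian diagPotential H X ⁅H, wedge (Qᵀ i) (Qᵀ j)⁆ = 0) : (Qᵀ * X * Q) i j = 0 := by
  rw [h.hessian_wedge hm hH hX hij] at h0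
  exact (mul_eq_zero.1 h0).resolve_left (mul_ne_zero (by norm_num) (sub_ne_zero.2 hij))

theorem diagonal_lie_eq_zero_of_coord (h : IsEigenframe H Q l)
    (hm : diagonal d * Q = Q * diagonal m) {X : Mat Λ}
    (h0 : ∀ i j, m i ≠ m j → (Qᵀ * X * Q) i j = 0) : ⁅diagonal d, X⁆ = 0 := by
  apply h.ext_coord
  ext i j
  rw [h.coord_lie hm]
  simp only [Matrix.mul_zero, Matrix.zero_mul, Matrix.zero_apply, mul_eq_zero, sub_eq_zero]
  by_cases hij : m i = m j
  · exact Or.inl hij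
  · exact Or.inr (h0 i j hij)

end IsEigenframe

theorem hessian_of_lie_eq_zero (hH : H ∈ critSlice Λ d) {X Y : Mat Λ} (hX : X ∈ isoTangent H)
    (hY : Y ∈ isoTangent H) (hd : ⁅diagonal d, X⁆ = 0) :
    hessian diagPotential H X Y = ∑ i, X i i * Y i i := by
  obtain ⟨Ω₁, h₁, rfl⟩ := hX
  obtain ⟨Ω₂, h₂, rfl⟩ := hY
  rw [hessian_eq_of_mem_critSlice hH h₁ h₂, hd, Matrix.zero_mul, trace_zero, add_zero]

/-- Testing `X` against wedges makes it commute with `Diag(d)`; testing it against itself then makes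
its diagonal vanish. -/
theorem nondegenerateOn_critNormal (hH : H ∈ critSlice Λ d) :
    NondegenerateOn (hessian diagPotential H) (critNormal d H) := by
  have key : ∀ X ∈ critNormal d H,
      (∀ Y ∈ critNormal d H, hessian diagPotential H X Y = 0) → X = 0 := by
    intro X hX h0
    obtain ⟨Q, hQ⟩ := exists_isEigenframe hH.1
    obtain ⟨m, hm⟩ := hQ.exists_mul_eq_of_commute hH.2.2
    have hd := hQ.diagonal_lie_eq_zero_of_coord hm fun i j hij =>
      hQ.coord_eq_zero_of_hessian hm hH hX.1 hij (h0 _ (hQ.wedge_mem_critNormal hm hH hij))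
    have h1 := h0 X hX
    rw [hessian_of_lie_eq_zero hH hX.1 hX.1 hd,
      Finset.sum_eq_zero_iff_of_nonneg fun _ _ => mul_self_nonneg _] at h1
    exact eq_zero_of_mem_critNormal hH hX hd fun i => mul_self_eq_zero.1 (h1 i (Finset.mem_univ i))
  refine ⟨key, fun Y hY h0 => key Y hY fun X hX => ?_⟩
  rw [hessian_comm hH hY.1 hX.1, h0 X hX]

end CritHessian

/-! ### The Morse–Bott property -/

section MorseBott

variable {Λ : Finset ℝ} {d : Fin Λ.card → ℝ}

theorem IsEigenframe.abs_entry_le {n : ℕ} {ι : Type*} [Fintype ι] [DecidableEq ι]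
    {H : Matrix (Fin n) (Fin n) ℝ} {Q : Matrix (Fin n) ι ℝ} {l : ι → ℝ} (h : IsEigenframe H Q l)
    (x y : Fin n) : |H x y| ≤ ∑ i, |l i| := by
  have hQ : ∀ x i, |Q x i| ≤ 1 := fun x i => by
    have e := congrFun (congrFun h.orth' x) x
    rw [Matrix.mul_apply, Matrix.one_apply_eq] at e
    simp only [transpose_apply] at e
    rw [← sq_le_one_iff_abs_le_one, ← e, sq]
    exact Finset.single_le_sum (f := fun i => Q x i * Q x i) (fun i _ => mul_self_nonneg _)
      (Finset.mem_univ i)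
  rw [h.eq_conj h.mul_eq, Matrix.mul_apply]
  refine (Finset.abs_sum_le_sum_abs _ _).trans (Finset.sum_le_sum fun i _ => ?_)
  rw [mul_diagonal, transpose_apply, abs_mul, abs_mul]
  calc |Q x i| * |l i| * |Q y i| ≤ 1 * |l i| * 1 := by
        gcongr
        · exact hQ x i
        · exact hQ y i
    _ = |l i| := by ring

/-- The slice is cut out by continuous equations, and orthonormality of eigenframes bounds the
entries by `∑ |λ_i|`. -/
theorem isCompact_critSlice : IsCompact (critSlice Λ d) := by
  set C := ∑ i, |Λ.orderEmbOfFin rfl i|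
  have hK : IsCompact (X := Mat Λ) (Set.univ.pi fun _ => Set.univ.pi fun _ => Set.Icc (-C) C) :=
    isCompact_univ_pi fun _ => isCompact_univ_pi fun _ => isCompact_Icc
  refine hK.of_isClosed_subset ?_ fun H hH x _ y _ => ?_
  · have e : critSlice Λ d = {H : Mat Λ | Hᵀ = H} ∩ {H | charValues Λ H = 0} ∩
        ((⋂ i, {H | H i i = d i}) ∩ {H | ⁅diagonal d, H⁆ = 0}) := by
      ext H
      simp only [critSlice, mem_isoSym_iff_det, Set.mem_ofPred_eq, Set.mem_inter_iff,
        Set.mem_iInter, funext_iff, charValues, Pi.zero_apply]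
    rw [e]
    refine ((isClosed_eq ?_ continuous_id).inter (isClosed_eq ?_ continuous_const)).inter
      ((isClosed_iInter fun i => isClosed_eq ?_ continuous_const).inter
        (isClosed_eq ?_ continuous_const))
    · exact continuous_id.matrix_transpose
    · exact contDiff_charValues.continuous
    · exact continuous_matrix_entry i i
    · change Continuous fun A : Mat Λ => diagonal d * A - A * diagonal d
      exact (continuous_const.mul continuous_id).sub (continuous_id.mul continuous_const)
  · obtain ⟨Q, hQ⟩ := exists_isEigenframe hH.1
    exact abs_le.1 (hQ.abs_entry_le x y)

theorem finite_critSlice (Λ : Finset ℝ) : {d | (critSlice Λ d).Nonempty}.Finite := by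
  refine (Set.Finite.pi' (t := fun _ : Fin Λ.card => ((Λ.powerset.image mean : Finset ℝ) : Set ℝ))
    fun _ => Finset.finite_toSet _).subset ?_
  rintro d ⟨H, hH⟩ i
  exact mem_image_mean_of_mem_critSlice hH i

/-- The critical points of the diagonal potential. -/
theorem isGradientAt_zero_iff {H : Mat Λ} (hH : H ∈ isoSym Λ) :
    IsGradientAt diagPotential H 0 ↔ H ∈ critSlice Λ fun i => H i i := by
  have h0 : (0 : Mat Λ) = ⁅H, (0 : Mat Λ)⁆ := by simp [Ring.lie_def]
  have hm : ∀ {Ω : Mat Λ}, IsSkew Ω → normalMetric H 0 ⁅H, Ω⁆ = 0 := fun hΩ => by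
    rw [h0, normalMetric_lie hH isSkew_zero hΩ]
    simp
  constructor
  · rintro ⟨-, h⟩
    -- Testing in the direction `Ω = [Diag(d), H]` gives `tr([Diag(d), H]²) = 0`.
    have hs := isSkew_lie_of_symm (diagonal_transpose fun i => H i i) hH.1
    refine ⟨hH, fun i => rfl, eq_zero_of_isSkew_of_trace hs ?_⟩
    rw [← sum_mul_diag_lie, ← dirDeriv_diagPotential hH hs, ← h _ ⟨_, hs, rfl⟩, hm hs]
  · rintro ⟨-, -, h⟩
    refine ⟨⟨0, isSkew_zero, h0.symm⟩, ?_⟩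
    rintro _ ⟨Ω, hΩ, rfl⟩
    rw [hm hΩ, dirDeriv_diagPotential hH hΩ, sum_mul_diag_lie, h, Matrix.zero_mul, trace_zero]

theorem exists_preconnected_critSlice (hΛ : StronglyDisjoint Λ) {H : Mat Λ}
    (hH : H ∈ critSlice Λ d) : ∃ T ⊆ critSlice Λ d, IsPreconnected T ∧ H ∈ T ∧
      ∀ᶠ X in 𝓝 H, X ∈ critSlice Λ d → X ∈ T := by
  obtain ⟨Φ, L, h1, -, -, -, h2⟩ := exists_critSlice_chart hΛ hH
    (Filter.Eventually.of_forall fun _ => Iff.rfl)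
  exact exists_preconnected_of_slice_chart hH h1 h2

theorem isMorseBott_diagPotential (hΛ : StronglyDisjoint Λ) : IsMorseBott Λ diagPotential := by
  refine ⟨⟨_, contDiff_diagPotential, fun _ _ => rfl⟩, ?_⟩
  -- The slices need not be connected, so their components serve as the critical submanifolds; as a
  -- set of sets, `𝓔` lists each one once.
  let 𝓔 : Set (Set (Mat Λ)) := ⋃ d ∈ {d | (critSlice Λ d).Nonempty},
    (fun H => connectedComponentIn (critSlice Λ d) H) '' critSlice Λ d
  have hfin : 𝓔.Finite := (finite_critSlice Λ).biUnion fun d _ =>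
    finite_components_of_isCompact isCompact_critSlice fun H hH =>
      exists_preconnected_critSlice hΛ hH
  have hmem : ∀ S : 𝓔, ∃ (d : _) (H : Mat Λ), H ∈ critSlice Λ d ∧
      connectedComponentIn (critSlice Λ d) H = S := by
    rintro ⟨S, hS⟩
    obtain ⟨d, -, H, hH, e⟩ := Set.mem_iUnion₂.1 hS
    exact ⟨d, H, hH, e⟩
  have := hfin.to_subtype
  obtain ⟨m, ⟨e⟩⟩ := Finite.exists_equiv_fin 𝓔
  refine ⟨m, fun i => (e.symm i).1, ?_, ?_, fun i => ?_⟩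
  · ext H
    rw [Set.mem_ofPred_eq, Set.mem_iUnion]
    constructor
    · rintro ⟨h1, h2⟩
      have hH := (isGradientAt_zero_iff h1).1 h2
      refine ⟨e ⟨connectedComponentIn (critSlice Λ fun i => H i i) H,
        Set.mem_iUnion₂.2 ⟨_, ⟨H, hH⟩, H, hH, rfl⟩⟩, ?_⟩
      rw [Equiv.symm_apply_apply]
      exact mem_connectedComponentIn hH
    · rintro ⟨i, hi⟩
      obtain ⟨d, H₀, -, hS⟩ := hmem (e.symm i)
      rw [← hS] at hi
      have hH := connectedComponentIn_subset _ _ hi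
      refine ⟨hH.1, (isGradientAt_zero_iff hH.1).2 ?_⟩
      rwa [show (fun i => H i i) = d from funext hH.2.1]
  · intro i j hij
    rw [Function.onFun, Set.disjoint_left]
    intro H hi hj
    obtain ⟨d, H₁, -, h1⟩ := hmem (e.symm i)
    obtain ⟨d', H₂, -, h2⟩ := hmem (e.symm j)
    rw [← h1] at hi
    rw [← h2] at hj
    -- A common point has a single diagonal, so both components lie in the same slice.
    obtain rfl : d = d' := by
      ext k
      rw [← (connectedComponentIn_subset _ _ hi).2.1 k, (connectedComponentIn_subset _ _ hj).2.1 k]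
    refine hij (e.symm.injective (Subtype.ext ?_))
    rw [← h1, ← h2, connectedComponentIn_eq hi, connectedComponentIn_eq hj]
  · obtain ⟨d, H₀, hH₀, hS⟩ := hmem (e.symm i)
    simp only [← hS]
    have hloc : ∀ H ∈ connectedComponentIn (critSlice Λ d) H₀, ∀ᶠ X in 𝓝 H,
        X ∈ connectedComponentIn (critSlice Λ d) H₀ ↔ X ∈ critSlice Λ d := fun H hH => by
      obtain ⟨T, hTS, hT, hHT, hev⟩ := exists_preconnected_critSlice hΛ
        (connectedComponentIn_subset _ _ hH)
      exact eventually_mem_connectedComponentIn_iff hH hTS hT hHT hev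
    refine ⟨⟨⟨H₀, mem_connectedComponentIn hH₀⟩, isPreconnected_connectedComponentIn⟩,
      ⟨Module.finrank ℝ (Mat Λ) - Module.finrank ℝ (critRange d), fun H hH => ?_⟩, fun H hH => ?_⟩
    · exact exists_critSlice_chart hΛ (connectedComponentIn_subset _ _ hH) (hloc H hH)
    · rw [normalSpace_eq_critNormal hΛ (connectedComponentIn_subset _ _ hH) (hloc H hH)]
      exact nondegenerateOn_critNormal (connectedComponentIn_subset _ _ hH)

end MorseBott

/-! ### Invariance under permutation matrices -/

section Permutation

variable {n : ℕ}

theorem permConj_eq_submatrix (σ : Equiv.Perm (Fin n)) (A : Matrix (Fin n) (Fin n) ℝ) :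
    permConj σ A = A.submatrix σ.symm σ.symm := by
  ext i j
  have h : ∀ k j, σ.permMatrix ℝ k j = if k = σ.symm j then 1 else 0 := fun k j => by
    simp [Equiv.Perm.permMatrix, PEquiv.toMatrix_apply, Equiv.eq_symm_apply, eq_comm]
  simp only [permConj, Matrix.mul_apply, transpose_apply, h]
  simp

theorem permConj_apply (σ : Equiv.Perm (Fin n)) (A : Matrix (Fin n) (Fin n) ℝ) (i j : Fin n) :
    permConj σ A i j = A (σ.symm i) (σ.symm j) := by
  rw [permConj_eq_submatrix, submatrix_apply]

theorem permConj_mul (σ : Equiv.Perm (Fin n)) (A B : Matrix (Fin n) (Fin n) ℝ) :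
    permConj σ (A * B) = permConj σ A * permConj σ B := by
  simp only [permConj_eq_submatrix, submatrix_mul_equiv]

theorem permConj_lie (σ : Equiv.Perm (Fin n)) (A B : Matrix (Fin n) (Fin n) ℝ) :
    permConj σ ⁅A, B⁆ = ⁅permConj σ A, permConj σ B⁆ := by
  rw [Ring.lie_def, Ring.lie_def, ← permConj_mul, ← permConj_mul]
  simp only [permConj_eq_submatrix, submatrix_sub]
  rfl

theorem permConj_smul (σ : Equiv.Perm (Fin n)) (c : ℝ) (A : Matrix (Fin n) (Fin n) ℝ) :
    permConj σ (c • A) = c • permConj σ A := by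
  ext; simp [permConj_apply]

theorem permConj_symm_permConj (σ : Equiv.Perm (Fin n)) (A : Matrix (Fin n) (Fin n) ℝ) :
    permConj σ (permConj σ.symm A) = A := by
  ext; simp [permConj_apply]

theorem permConj_isSkew (σ : Equiv.Perm (Fin n)) {Ω : Matrix (Fin n) (Fin n) ℝ} (h : IsSkew Ω) :
    IsSkew (permConj σ Ω) := by
  ext i j
  rw [transpose_apply, permConj_apply, Matrix.neg_apply, permConj_apply]
  exact congrFun (congrFun h (σ.symm i)) (σ.symm j)

variable {Λ : Finset ℝ} {H : Mat Λ}

theorem permConj_mem_isoSym (σ : Equiv.Perm (Fin Λ.card)) (hH : H ∈ isoSym Λ) :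
    permConj σ H ∈ isoSym Λ := by
  refine ⟨?_, ?_⟩
  · rw [permConj_eq_submatrix, transpose_submatrix, hH.1]
  · rw [permConj_eq_submatrix, ← hH.2]
    exact Matrix.charpoly_reindex σ H

theorem permConj_mem_critSlice (σ : Equiv.Perm (Fin Λ.card)) {d : Fin Λ.card → ℝ}
    (hH : H ∈ critSlice Λ d) : permConj σ H ∈ critSlice Λ (d ∘ σ.symm) := by
  refine ⟨permConj_mem_isoSym σ hH.1, fun i => ?_, diagonal_lie_eq_zero_iff.2 fun i j hij => ?_⟩
  · rw [permConj_apply, hH.2.1, Function.comp]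
  · rw [permConj_apply]
    exact diagonal_lie_eq_zero_iff.1 hH.2.2 _ _ hij

theorem permConj_image_critSlice (σ : Equiv.Perm (Fin Λ.card)) (d : Fin Λ.card → ℝ) :
    permConj σ '' critSlice Λ d = critSlice Λ (d ∘ σ.symm) := by
  apply subset_antisymm
  · rintro _ ⟨H, hH, rfl⟩
    exact permConj_mem_critSlice σ hH
  · intro H hH
    refine ⟨permConj σ.symm H, ?_, permConj_symm_permConj σ H⟩
    have := permConj_mem_critSlice σ.symm hH
    rwa [Function.comp_assoc, Equiv.symm_symm, Equiv.symm_comp_self, Function.comp_id] at this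

theorem permConj_mem_isoTangent (σ : Equiv.Perm (Fin Λ.card)) {X : Mat Λ} (hX : X ∈ isoTangent H) :
    permConj σ X ∈ isoTangent (permConj σ H) := by
  obtain ⟨Ω, hΩ, rfl⟩ := hX
  exact ⟨_, permConj_isSkew σ hΩ, (permConj_lie σ H Ω).symm⟩

/-- The formula `hessian_lie` involves only brackets and sums over the diagonal, and both are
compatible with relabelling of indices. -/
theorem hessian_permConj (σ : Equiv.Perm (Fin Λ.card)) (hH : H ∈ isoSym Λ) {X Y : Mat Λ}
    (hX : X ∈ isoTangent H) (hY : Y ∈ isoTangent H) :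
    hessian diagPotential (permConj σ H) (permConj σ X) (permConj σ Y) =
      hessian diagPotential H X Y := by
  obtain ⟨Ω₁, h₁, rfl⟩ := hX
  obtain ⟨Ω₂, h₂, rfl⟩ := hY
  rw [permConj_lie, permConj_lie, hessian_lie (permConj_mem_isoSym σ hH) (permConj_isSkew σ h₁)
    (permConj_isSkew σ h₂), hessian_lie hH h₁ h₂]
  simp only [← permConj_lie, ← permConj_smul]
  simp only [permConj_apply]
  congr 1
  · congr 1
    · exact Equiv.sum_comp σ.symm fun i => ⁅H, Ω₁⁆ i i * ⁅H, Ω₂⁆ i i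
    · exact Equiv.sum_comp σ.symm fun i => H i i * ⁅⁅H, Ω₁⁆, Ω₂⁆ i i
  · exact Equiv.sum_comp σ.symm fun i => H i i * ⁅H, (1 / 2 : ℝ) • ⁅Ω₁, Ω₂⁆⁆ i i

end Permutation

/-- Removing the intersection leaves disjoint sets of equal size and equal sum, hence of equal mean.
-/
theorem StronglyDisjoint.eq_of_mean_eq {Λ A B : Finset ℝ} (hΛ : StronglyDisjoint Λ) (hA : A ⊆ Λ)
    (hB : B ⊆ Λ) (hc : A.card = B.card) (hm : mean A = mean B) : A = B := by
  by_contra hne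
  have hs : (A \ B).card = (B \ A).card := Finset.card_sdiff_comm hc
  have h1 : (A \ B).Nonempty := by
    rw [Finset.sdiff_nonempty]
    exact fun h => hne (Finset.eq_of_subset_of_card_le h hc.ge)
  have h2 : (B \ A).Nonempty := by rwa [← Finset.card_pos, ← hs, Finset.card_pos]
  refine hΛ _ _ (Finset.sdiff_subset.trans hA) (Finset.sdiff_subset.trans hB) h1 h2
    disjoint_sdiff_sdiff ?_
  have hsum : ∑ x ∈ A, x = ∑ x ∈ B, x := by
    have hA0 : (A.card : ℝ) ≠ 0 := by
      exact_mod_cast (h1.mono Finset.sdiff_subset).card_pos.ne'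
    rw [mean, mean, ← hc] at hm
    field_simp at hm
    exact hm
  have e1 := Finset.sum_inter_add_sum_sdiff A B fun x => x
  have e2 := Finset.sum_inter_add_sum_sdiff B A fun x => x
  rw [Finset.inter_comm] at e2
  rw [mean, mean, hs]
  congr 1
  linarith

/-! ### The sets `E_α` as critical slices, and block eigenframes -/

namespace OrderedPartition

variable {Λ : Finset ℝ} (α : OrderedPartition Λ)

theorem part_subset (i : Fin α.k) : α.part i ⊆ Λ := by
  intro x hx
  rw [← α.cover]
  exact Finset.mem_biUnion.2 ⟨i, Finset.mem_univ i, hx⟩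

theorem prod_parts : ∏ i, ∏ l ∈ α.part i, (X - C l : ℝ[X]) = ∏ l ∈ Λ, (X - C l) := by
  conv_rhs => rw [← α.cover]
  rw [Finset.prod_biUnion]
  exact fun i _ j _ hij => α.disjoint hij

/-- The diagonal of the points of `E_α`. -/
noncomputable def level (x : Fin Λ.card) : ℝ := mean (α.part (α.blockEquiv.symm x).1)

theorem mean_part_inj (hΛ : StronglyDisjoint Λ) {i j : Fin α.k}
    (h : mean (α.part i) = mean (α.part j)) : i = j := by
  by_contra hne
  exact hΛ _ _ (α.part_subset i) (α.part_subset j) (α.nonempty i) (α.nonempty j)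
    (α.disjoint hne) h

theorem diag_apply (B : α.Blocks) (x y : Σ i : Fin α.k, Fin (α.size i)) :
    α.diag B (α.blockEquiv x) (α.blockEquiv y) = blockDiagonal' B x y := by
  simp [diag]

theorem ext_block {A B : Mat Λ}
    (h : ∀ x y, A (α.blockEquiv x) (α.blockEquiv y) = B (α.blockEquiv x) (α.blockEquiv y)) :
    A = B := by
  ext i j
  simpa using h (α.blockEquiv.symm i) (α.blockEquiv.symm j)

theorem diag_transpose (B : α.Blocks) : (α.diag B)ᵀ = α.diag fun i => (B i)ᵀ := by
  rw [diag, transpose_reindex, blockDiagonal'_transpose]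
  rfl

theorem diag_mul (B B' : α.Blocks) : α.diag B * α.diag B' = α.diag fun i => B i * B' i := by
  simp only [diag, blockDiagonal'_mul, reindex_apply, submatrix_mul_equiv]

theorem diag_sub (B B' : α.Blocks) : α.diag (B - B') = α.diag B - α.diag B' := by
  rw [diag, blockDiagonal'_sub]
  rfl

theorem diag_lie (B B' : α.Blocks) :
    ⁅α.diag B, α.diag B'⁆ = α.diag fun i => ⁅B i, B' i⁆ := by
  rw [Ring.lie_def, diag_mul, diag_mul, ← diag_sub]
  rfl

theorem charpoly_diag (B : α.Blocks) : (α.diag B).charpoly = ∏ i, (B i).charpoly := by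
  have himg : Finset.univ.image (Sigma.fst : (Σ i : Fin α.k, Fin (α.size i)) → Fin α.k) =
      Finset.univ := by
    ext i
    have : 0 < α.size i := (α.nonempty i).card_pos
    simp only [Finset.mem_image, Finset.mem_univ, true_and, iff_true]
    exact ⟨⟨i, ⟨0, this⟩⟩, rfl⟩
  rw [diag, Matrix.charpoly_reindex, (blockTriangular_blockDiagonal' B).charpoly, himg]
  refine Finset.prod_congr rfl fun i _ => ?_
  rw [← Matrix.charpoly_reindex (Equiv.sigmaSubtype i)]
  congr 1
  ext a b
  exact blockDiagonal'_apply_eq B i a b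

theorem diag_mem_critSlice {B : α.Blocks} (hB : α.IsCritical B) :
    α.diag B ∈ critSlice Λ α.level := by
  refine ⟨⟨?_, ?_⟩, fun x => ?_, diagonal_lie_eq_zero_iff.2 fun x y hxy => ?_⟩
  · rw [diag_transpose]
    congr 1
    exact funext fun i => (hB i).1.1
  · rw [charpoly_diag, ← α.prod_parts]
    exact Finset.prod_congr rfl fun i _ => (hB i).1.2
  · obtain ⟨⟨i, a⟩, rfl⟩ := α.blockEquiv.surjective x
    rw [diag_apply, blockDiagonal'_apply_eq, (hB i).2, level, Equiv.symm_apply_apply]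
  · obtain ⟨⟨i, a⟩, rfl⟩ := α.blockEquiv.surjective x
    obtain ⟨⟨j, b⟩, rfl⟩ := α.blockEquiv.surjective y
    simp only [level, Equiv.symm_apply_apply] at hxy
    rw [diag_apply, blockDiagonal'_apply_ne]
    rintro rfl
    exact hxy rfl

/-- The condition on the diagonal fixes size and mean of each block's spectrum, and strong
disjointness then identifies that spectrum with the prescribed part. -/
theorem E_eq_critSlice (hΛ : StronglyDisjoint Λ) : α.E = critSlice Λ α.level := by
  apply subset_antisymm
  · rintro _ ⟨B, hB, rfl⟩
    exact α.diag_mem_critSlice hB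
  · intro H hH
    let B : α.Blocks := fun i => Matrix.of fun a b => H (α.blockEquiv ⟨i, a⟩) (α.blockEquiv ⟨i, b⟩)
    have hBH : α.diag B = H := by
      refine α.ext_block ?_
      rintro ⟨i, a⟩ ⟨j, b⟩
      rw [diag_apply]
      by_cases h : i = j
      · subst h
        rw [blockDiagonal'_apply_eq]
        rfl
      · rw [blockDiagonal'_apply_ne _ _ _ h, diagonal_lie_eq_zero_iff.1 hH.2.2]
        simp only [level, Equiv.symm_apply_apply]
        exact fun e => h (α.mean_part_inj hΛ e)
    have hdiag : ∀ i a, B i a a = mean (α.part i) := fun i a => by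
      have := hH.2.1 (α.blockEquiv ⟨i, a⟩)
      rwa [level, Equiv.symm_apply_apply] at this
    refine ⟨B, fun i => ⟨⟨?_, ?_⟩, hdiag i⟩, hBH⟩
    · ext a b
      exact congrFun (congrFun hH.1.1 _) _
    · obtain ⟨A, hA, -⟩ := exists_factor_roots (Λ := Λ) (s := Finset.univ)
        (p := fun i => (B i).charpoly) (fun i _ => Matrix.charpoly_monic _)
        (by rw [← charpoly_diag, hBH, hH.1.2])
      obtain ⟨hs, hp⟩ := hA i (Finset.mem_univ i)
      rw [hp]
      have hc : (A i).card = (α.part i).card := by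
        have := congrArg natDegree hp
        rw [Matrix.charpoly_natDegree_eq_dim, natDegree_finsetProd_X_sub_C_eq_card,
          Fintype.card_fin] at this
        exact this.symm
      rw [hΛ.eq_of_mean_eq hs (α.part_subset i) hc]
      have h := (B i).trace_eq_neg_charpoly_nextCoeff
      rw [hp, prod_X_sub_C_nextCoeff, neg_neg] at h
      rw [mean, ← h, Matrix.trace]
      simp only [Matrix.diag_apply]
      rw [Finset.sum_congr rfl (g := fun _ => mean (α.part i))
        (fun a _ => hdiag i a), hc, Finset.sum_const, Finset.card_univ, Fintype.card_fin,
        nsmul_eq_mul, mul_div_cancel_left₀]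
      exact_mod_cast (α.nonempty i).card_pos.ne'

theorem extend_apply (p : Fin α.k) (v : Fin (α.size p) → ℝ)
    (x : Σ i : Fin α.k, Fin (α.size i)) :
    α.extend p v (α.blockEquiv x) = (Pi.single p v : ∀ i, Fin (α.size i) → ℝ) x.1 x.2 := by
  rw [extend, Equiv.symm_apply_apply]

theorem sum_extend_mul (p : Fin α.k) (v : Fin (α.size p) → ℝ) (f : Fin Λ.card → ℝ) :
    ∑ x, α.extend p v x * f x = ∑ a, v a * f (α.blockEquiv ⟨p, a⟩) := by
  rw [← Equiv.sum_comp α.blockEquiv, Fintype.sum_sigma, Fintype.sum_eq_single p]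
  · simp [extend_apply]
  · intro q hq
    simp [extend_apply, hq]

theorem extend_dotProduct_self (p : Fin α.k) (v w : Fin (α.size p) → ℝ) :
    α.extend p v ⬝ᵥ α.extend p w = v ⬝ᵥ w := by
  rw [dotProduct, sum_extend_mul]
  simp [extend_apply, dotProduct]

theorem extend_dotProduct_of_ne {p q : Fin α.k} (h : p ≠ q) (v : Fin (α.size p) → ℝ)
    (w : Fin (α.size q) → ℝ) : α.extend p v ⬝ᵥ α.extend q w = 0 := by
  rw [dotProduct, sum_extend_mul]
  simp [extend_apply, h]

theorem diag_mulVec_extend (B : α.Blocks) (p : Fin α.k) (v : Fin (α.size p) → ℝ) :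
    α.diag B *ᵥ α.extend p v = α.extend p (B p *ᵥ v) := by
  ext x
  obtain ⟨⟨i, a⟩, rfl⟩ := α.blockEquiv.surjective x
  rw [mulVec, dotProduct_comm, dotProduct, sum_extend_mul, extend_apply]
  by_cases h : i = p
  · subst h
    simp [diag_apply, mulVec, dotProduct, mul_comm]
  · simp [diag_apply, h, blockDiagonal'_apply_ne]

theorem extend_smul (p : Fin α.k) (c : ℝ) (v : Fin (α.size p) → ℝ) :
    α.extend p (c • v) = c • α.extend p v := by
  ext x
  obtain ⟨⟨i, a⟩, rfl⟩ := α.blockEquiv.surjective x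
  rw [Pi.smul_apply, extend_apply, extend_apply]
  by_cases h : i = p
  · subst h; simp
  · simp [h]

theorem diagonal_level_mulVec_extend (p : Fin α.k) (v : Fin (α.size p) → ℝ) :
    diagonal α.level *ᵥ α.extend p v = mean (α.part p) • α.extend p v := by
  ext x
  obtain ⟨⟨i, a⟩, rfl⟩ := α.blockEquiv.surjective x
  rw [mulVec_diagonal, Pi.smul_apply, extend_apply, level, Equiv.symm_apply_apply]
  by_cases h : i = p
  · subst h; rfl
  · simp [h]

theorem eig_mem (i : Fin α.k) (a : Fin (α.size i)) : α.eig i a ∈ α.part i :=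
  Finset.orderEmbOfFin_mem _ _ _

theorem eig_injective :
    Function.Injective fun x : Σ i : Fin α.k, Fin (α.size i) => α.eig x.1 x.2 := by
  rintro ⟨i, a⟩ ⟨j, b⟩ h
  have hij : i = j := by
    by_contra hne
    exact Finset.disjoint_left.1 (α.disjoint hne) (α.eig_mem i a)
      (by rw [show α.eig i a = α.eig j b from h]; exact α.eig_mem j b)
  subst hij
  exact congrArg _ (((α.part i).orderEmbOfFin rfl).injective h)

/-- The matrix whose columns are the extensions by zero of the vectors `v`. -/
def frame (v : ∀ i : Fin α.k, Fin (α.size i) → Fin (α.size i) → ℝ) :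
    Matrix (Fin Λ.card) (Σ i : Fin α.k, Fin (α.size i)) ℝ :=
  Matrix.of fun x i => α.extend i.1 (v i.1 i.2) x

variable {α} {B : α.Blocks} {v : ∀ i : Fin α.k, Fin (α.size i) → Fin (α.size i) → ℝ}

theorem isEigenframe_frame (hB : α.IsCritical B) (hv : α.IsUnitEigen B v) :
    IsEigenframe (α.diag B) (α.frame v) fun x => α.eig x.1 x.2 := by
  refine IsEigenframe.of_unit_eigenvectors (α.diag_mem_critSlice hB).1.1
    (fun i => α.extend i.1 (v i.1 i.2)) α.eig_injective (fun i => ?_) (fun i => ?_) ?_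
  · rw [diag_mulVec_extend, (hv i.1 i.2).1, extend_smul]
  · rw [extend_dotProduct_self, (hv i.1 i.2).2]
  · simp [α.sum_size]

theorem diagonal_level_mul_frame :
    diagonal α.level * α.frame v = α.frame v * diagonal fun x => mean (α.part x.1) := by
  ext x i
  have := congrFun (α.diagonal_level_mulVec_extend i.1 (v i.1 i.2)) x
  rw [Pi.smul_apply, smul_eq_mul, mul_comm] at this
  exact this.trans (Matrix.mul_diagonal (fun x : Σ i : Fin α.k, Fin (α.size i) => mean (α.part x.1))
    (α.frame v) x i).symm

/-- The index in the frame of the first factor of `N_{pq,ij}`. -/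
def OffIndex.fst (x : α.OffIndex) : Σ i : Fin α.k, Fin (α.size i) := ⟨x.1.1.1, x.2.1⟩

/-- The index in the frame of the second factor of `N_{pq,ij}`. -/
def OffIndex.snd (x : α.OffIndex) : Σ i : Fin α.k, Fin (α.size i) := ⟨x.1.1.2, x.2.2⟩

theorem OffIndex.mean_ne (hΛ : StronglyDisjoint Λ) (x : α.OffIndex) :
    mean (α.part (OffIndex.fst x).1) ≠ mean (α.part (OffIndex.snd x).1) :=
  fun h => (ne_of_lt x.1.2) (α.mean_part_inj hΛ h)

theorem OffIndex.ext_fst_snd {x x' : α.OffIndex} (h1 : OffIndex.fst x = OffIndex.fst x')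
    (h2 : OffIndex.snd x = OffIndex.snd x') : x = x' := by
  obtain ⟨⟨⟨p, q⟩, hpq⟩, a, b⟩ := x
  obtain ⟨⟨⟨p', q'⟩, hpq'⟩, a', b'⟩ := x'
  simp only [OffIndex.fst, OffIndex.snd, Sigma.mk.injEq] at h1 h2
  obtain ⟨rfl, h1⟩ := h1
  obtain ⟨rfl, h2⟩ := h2
  rw [eq_of_heq h1, eq_of_heq h2]

/-- This brings the off-block vectors under the wedge computations for a general eigenframe. -/
theorem offVec_eq_lie_wedge (hB : α.IsCritical B) (hv : α.IsUnitEigen B v) (x : α.OffIndex) :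
    α.offVec v x =
      ⁅α.diag B, wedge ((α.frame v)ᵀ (OffIndex.fst x)) ((α.frame v)ᵀ (OffIndex.snd x))⁆ := by
  have h := isEigenframe_frame hB hv
  rw [lie_wedge h.symm (mulVec_eq_of_mul_eq h.mul_eq _) (mulVec_eq_of_mul_eq h.mul_eq _)]
  rfl

theorem diag_single_lie (p : Fin α.k) (M : Matrix (Fin (α.size p)) (Fin (α.size p)) ℝ) :
    α.diag (Pi.single p ⁅B p, M⁆) = ⁅α.diag B, α.diag (Pi.single p M)⁆ := by
  rw [diag_lie]
  congr 1
  ext1 i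
  by_cases h : i = p
  · subst h; simp
  · simp [h, Ring.lie_def]

theorem diag_single_diagonal_lie (p : Fin α.k) (e : Fin (α.size p) → ℝ) :
    α.diag (Pi.single p ⁅diagonal e, B p⁆) = ⁅diagonal (α.extend p e), α.diag B⁆ := by
  have h1 : diagonal (α.extend p e) = α.diag (Pi.single p (diagonal e)) := by
    refine α.ext_block ?_
    rintro ⟨i, a⟩ ⟨j, b⟩
    rw [diag_apply]
    by_cases h : i = j
    · subst h
      rw [blockDiagonal'_apply_eq]
      by_cases hp : i = p
      · subst hp
        by_cases hab : a = b
        · subst hab; simp [extend_apply]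
        · rw [diagonal_apply_ne _ (by simpa using hab)]
          simp [hab]
      · by_cases hab : a = b
        · subst hab; simp [extend_apply, hp]
        · rw [diagonal_apply_ne _ (by simpa using hab)]
          simp [hp]
    · rw [blockDiagonal'_apply_ne _ _ _ h, diagonal_apply_ne]
      intro e
      exact h (congrArg Sigma.fst (α.blockEquiv.injective e))
  rw [h1, diag_lie]
  congr 1
  ext1 i
  by_cases h : i = p
  · subst h; simp
  · simp [h, Ring.lie_def]

theorem diag_single_apply_self (p : Fin α.k) (M : Matrix (Fin (α.size p)) (Fin (α.size p)) ℝ)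
    (x : Fin Λ.card) : α.diag (Pi.single p M) x x = α.extend p (fun a => M a a) x := by
  obtain ⟨⟨i, a⟩, rfl⟩ := α.blockEquiv.surjective x
  rw [diag_apply, blockDiagonal'_apply_eq, extend_apply]
  by_cases h : i = p
  · subst h; simp
  · simp [h]

end OrderedPartition

/-! ### Bases from Hessian-orthogonal families -/

section HessianBasis

variable {Λ : Finset ℝ} {d : Fin Λ.card → ℝ} {H : Mat Λ}

theorem normalMetric_add_left (hH : H ∈ isoSym Λ) {X Y Z : Mat Λ} (hX : X ∈ isoTangent H)
    (hY : Y ∈ isoTangent H) (hZ : Z ∈ isoTangent H) :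
    normalMetric H (X + Y) Z = normalMetric H X Z + normalMetric H Y Z := by
  obtain ⟨Ω₁, h₁, rfl⟩ := hX
  obtain ⟨Ω₂, h₂, rfl⟩ := hY
  obtain ⟨Ω₃, h₃, rfl⟩ := hZ
  have e : ⁅H, Ω₁⁆ + ⁅H, Ω₂⁆ = ⁅H, Ω₁ + Ω₂⁆ := by
    simp only [Ring.lie_def]
    noncomm_ring
  rw [e, normalMetric_lie hH (h₁.add h₂) h₃, normalMetric_lie hH h₁ h₃, normalMetric_lie hH h₂ h₃,
    Matrix.add_mul, trace_add, neg_add]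

theorem normalMetric_smul_left (hH : H ∈ isoSym Λ) (c : ℝ) {X Z : Mat Λ} (hX : X ∈ isoTangent H)
    (hZ : Z ∈ isoTangent H) : normalMetric H (c • X) Z = c * normalMetric H X Z := by
  obtain ⟨Ω₁, h₁, rfl⟩ := hX
  obtain ⟨Ω₃, h₃, rfl⟩ := hZ
  have e : c • ⁅H, Ω₁⁆ = ⁅H, c • Ω₁⁆ := by simp [Ring.lie_def, smul_sub]
  rw [e, normalMetric_lie hH (h₁.smul c) h₃, normalMetric_lie hH h₁ h₃, Matrix.smul_mul, trace_smul,
    smul_eq_mul, mul_neg]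

/-- The critical normal space as a submodule. -/
def critNormalSubmodule (hH : H ∈ critSlice Λ d) : Submodule ℝ (Mat Λ) where
  carrier := critNormal d H
  add_mem' hX hY := ⟨isoTangent_add hX.1 hY.1, fun Z hZ => by
    rw [normalMetric_add_left hH.1 hX.1 hY.1 hZ.1, hX.2 Z hZ, hY.2 Z hZ, add_zero]⟩
  zero_mem' := by
    have h0 : (0 : Mat Λ) ∈ isoTangent H := ⟨0, isSkew_zero, by simp [Ring.lie_def]⟩
    refine ⟨h0, fun Z hZ => ?_⟩
    have := normalMetric_smul_left hH.1 0 h0 hZ.1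
    rwa [zero_smul, zero_mul] at this
  smul_mem' c X hX := ⟨isoTangent_smul c hX.1, fun Z hZ => by
    rw [normalMetric_smul_left hH.1 c hX.1 hZ.1, hX.2 Z hZ, mul_zero]⟩

theorem hessian_sum_left (hH : H ∈ critSlice Λ d) {κ : Type*} {s : κ → Mat Λ}
    (hs : ∀ k, s k ∈ critNormal d H) (c : κ → ℝ) (t : Finset κ) {Z : Mat Λ}
    (hZ : Z ∈ isoTangent H) :
    hessian diagPotential H (∑ k ∈ t, c k • s k) Z =
      ∑ k ∈ t, c k * hessian diagPotential H (s k) Z := by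
  classical
  induction t using Finset.induction_on with
  | empty =>
    have h0 : (0 : Mat Λ) ∈ isoTangent H := ⟨0, isSkew_zero, by simp [Ring.lie_def]⟩
    have := hessian_smul_left hH 0 h0 hZ
    rw [zero_smul, zero_mul] at this
    simpa using this
  | insert k t hk ih =>
    have ht : ∑ k ∈ t, c k • s k ∈ isoTangent H :=
      ((critNormalSubmodule hH).sum_mem fun k _ =>
        (critNormalSubmodule hH).smul_mem (c k) (hs k) : _ ∈ critNormal d H).1
    rw [Finset.sum_insert hk, Finset.sum_insert hk,
      hessian_add_left hH (isoTangent_smul _ (hs k).1) ht hZ, hessian_smul_left hH _ (hs k).1 hZ, ih]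

/-- A Hessian-orthogonal family of normal vectors that are not null and whose orthogonal in the
normal space vanishes is a basis of the normal space. -/
theorem basis_of_hessian_orthogonal (hH : H ∈ critSlice Λ d) {κ : Type*} [Fintype κ]
    {s : κ → Mat Λ} (hs : ∀ k, s k ∈ critNormal d H)
    (horth : ∀ k k', k ≠ k' → hessian diagPotential H (s k) (s k') = 0)
    (hne : ∀ k, hessian diagPotential H (s k) (s k) ≠ 0)
    (hcompl : ∀ X ∈ critNormal d H, (∀ k, hessian diagPotential H X (s k) = 0) → X = 0) :
    LinearIndependent ℝ s ∧
      (Submodule.span ℝ (Set.range s) : Set (Mat Λ)) = critNormal d H := by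
  have hsum : ∀ (c : κ → ℝ) (k : κ), hessian diagPotential H (∑ i, c i • s i) (s k) =
      c k * hessian diagPotential H (s k) (s k) := fun c k => by
    rw [hessian_sum_left hH hs c _ (hs k).1, Finset.sum_eq_single k]
    · intro i _ hik
      rw [horth i k hik, mul_zero]
    · simp
  have h0 : ∀ Z ∈ isoTangent H, hessian diagPotential H 0 Z = 0 := fun Z hZ => by
    simpa using hessian_sum_left hH hs 0 ∅ hZ
  refine ⟨Fintype.linearIndependent_iff.2 fun c hc k => ?_, subset_antisymm ?_ fun X hX => ?_⟩
  · have := hsum c k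
    rw [hc, h0 _ (hs k).1] at this
    exact (mul_eq_zero.1 this.symm).resolve_right (hne k)
  · have : Submodule.span ℝ (Set.range s) ≤ critNormalSubmodule hH := by
      rw [Submodule.span_le]
      rintro _ ⟨k, rfl⟩
      exact hs k
    exact this
  -- Minus the Hessian projections of `X`; the corrected vector is orthogonal to the family.
  · let c : κ → ℝ := fun k =>
      -(hessian diagPotential H X (s k) / hessian diagPotential H (s k) (s k))
    have hc : ∑ k, c k • s k ∈ critNormal d H :=
      (critNormalSubmodule hH).sum_mem fun k _ => (critNormalSubmodule hH).smul_mem (c k) (hs k)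
    have hz := hcompl (X + ∑ k, c k • s k) ((critNormalSubmodule hH).add_mem hX hc) fun k => by
      rw [hessian_add_left hH hX.1 hc.1 (hs k).1, hsum, neg_mul, div_mul_cancel₀ _ (hne k),
        add_neg_cancel]
    rw [eq_neg_of_add_eq_zero_left hz]
    exact Submodule.neg_mem _ (Submodule.sum_mem _ fun k _ =>
      Submodule.smul_mem _ _ (Submodule.subset_span ⟨k, rfl⟩))

/-- Its metric pairing with `[H, Ω]` is `-∑ f_i [H, Ω]_ii`, and vectors tangent to the slice have
zero diagonal. -/
theorem lie_diagonal_lie_mem_critNormal (hH : H ∈ critSlice Λ d) (f : Fin Λ.card → ℝ) :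
    ⁅H, ⁅diagonal f, H⁆⁆ ∈ critNormal d H := by
  have hs := isSkew_lie_of_symm (diagonal_transpose f) hH.1.1
  refine ⟨⟨_, hs, rfl⟩, ?_⟩
  rintro _ ⟨⟨Ω, hΩ, rfl⟩, -, h0⟩
  rw [normalMetric_lie hH.1 hs hΩ, ← sum_mul_diag_lie]
  simp [h0]

end HessianBasis

/-- An orthonormal basis of the hyperplane `(1, …, 1)^⊥` and `(1, …, 1)` have no common
orthogonal vector. -/
theorem eq_zero_of_orthogonal_hyperplane_basis {m : ℕ} (hm : 0 < m) {u : Fin (m - 1) → Fin m → ℝ}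
    (h1 : ∀ j, ∑ a, u j a = 0) (h2 : ∀ j j', u j ⬝ᵥ u j' = if j = j' then 1 else 0)
    {z : Fin m → ℝ} (hz : ∑ a, z a = 0) (hzu : ∀ j, ∑ a, z a * u j a = 0) : z = 0 := by
  -- Adjoining the row of ones, of squared length `m`, makes the matrix square; the weights `D` turn
  -- its transpose into an inverse.
  let M : Matrix (Option (Fin (m - 1))) (Fin m) ℝ := Matrix.of fun o => o.elim (fun _ => 1) u
  let D : Option (Fin (m - 1)) → ℝ := fun o => o.elim (m : ℝ)⁻¹ fun _ => 1
  have hm0 : (m : ℝ) ≠ 0 := by exact_mod_cast hm.ne'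
  have h : M * (Mᵀ * diagonal D) = 1 := by
    rw [← Matrix.mul_assoc]
    ext o o'
    rw [mul_diagonal, Matrix.mul_apply]
    rcases o with _ | j <;> rcases o' with _ | j'
    · simp [M, D, hm0]
    · simp [M, D, h1]
    · simp [M, D, h1]
    · have := h2 j j'
      simp only [dotProduct] at this
      simp [M, D, this, Matrix.one_apply]
  rw [Matrix.mul_eq_one_comm_of_card_eq _ _ _ (by simp; omega)] at h
  have hMz : M *ᵥ z = 0 := by
    ext o
    rcases o with _ | j
    · simpa [M, mulVec, dotProduct] using hz
    · simpa [M, mulVec, dotProduct, mul_comm] using hzu j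
  rw [← Matrix.one_mulVec z, ← h, ← mulVec_mulVec, hMz, mulVec_zero]

/-! ### The explicit basis of the normal space of `E_α` -/

namespace OrderedPartition

variable {Λ : Finset ℝ} {α : OrderedPartition Λ} {B : α.Blocks}
  {v : ∀ i : Fin α.k, Fin (α.size i) → Fin (α.size i) → ℝ}
  {u : ∀ i : Fin α.k, Fin (α.size i - 1) → Fin (α.size i) → ℝ}
  {Ω : ∀ i : Fin α.k, Fin (α.size i - 1) → Matrix (Fin (α.size i)) (Fin (α.size i)) ℝ}

theorem offVec_mem_critNormal (hΛ : StronglyDisjoint Λ) (hB : α.IsCritical B)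
    (hv : α.IsUnitEigen B v) (x : α.OffIndex) :
    α.offVec v x ∈ critNormal α.level (α.diag B) := by
  rw [offVec_eq_lie_wedge hB hv]
  exact (isEigenframe_frame hB hv).wedge_mem_critNormal diagonal_level_mul_frame
    (α.diag_mem_critSlice hB) (OffIndex.mean_ne hΛ x)

theorem offVec_apply_self (hΛ : StronglyDisjoint Λ) (hB : α.IsCritical B)
    (hv : α.IsUnitEigen B v) (x : α.OffIndex) (y : Fin Λ.card) : α.offVec v x y y = 0 := by
  rw [offVec_eq_lie_wedge hB hv]
  exact (isEigenframe_frame hB hv).lie_wedge_diag diagonal_level_mul_frame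
    (OffIndex.mean_ne hΛ x) y

theorem hessian_offVec (hΛ : StronglyDisjoint Λ) (hB : α.IsCritical B) (hv : α.IsUnitEigen B v)
    {X : Mat Λ} (hX : X ∈ isoTangent (α.diag B)) (x : α.OffIndex) :
    hessian diagPotential (α.diag B) X (α.offVec v x) =
      -2 * (mean (α.part (OffIndex.fst x).1) - mean (α.part (OffIndex.snd x).1)) *
        ((α.frame v)ᵀ * X * α.frame v) (OffIndex.fst x) (OffIndex.snd x) := by
  rw [offVec_eq_lie_wedge hB hv]
  exact (isEigenframe_frame hB hv).hessian_wedge diagonal_level_mul_frame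
    (α.diag_mem_critSlice hB) hX (OffIndex.mean_ne hΛ x)

theorem coord_offVec (hB : α.IsCritical B) (hv : α.IsUnitEigen B v) (x x' : α.OffIndex) :
    ((α.frame v)ᵀ * α.offVec v x * α.frame v) (OffIndex.fst x') (OffIndex.snd x') =
      if x = x' then α.eig x.1.1.1 x.2.1 - α.eig x.1.1.2 x.2.2 else 0 := by
  have h := isEigenframe_frame hB hv
  have horth : ∀ i j, (α.frame v)ᵀ i ⬝ᵥ (α.frame v)ᵀ j = (1 : Matrix _ _ ℝ) i j := fun i j => by
    rw [← h.orth, Matrix.mul_apply]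
    rfl
  -- The ordering `p < q` of block indices excludes a match with the two factors exchanged.
  have hne : ¬ (OffIndex.fst x' = OffIndex.snd x ∧ OffIndex.fst x = OffIndex.snd x') := by
    rintro ⟨e1, e2⟩
    have e1 := congrArg Sigma.fst e1
    have e2 := congrArg Sigma.fst e2
    simp only [OffIndex.fst, OffIndex.snd] at e1 e2
    exact lt_asymm x.1.2 (by rw [← e1, e2]; exact x'.1.2)
  rw [offVec_eq_lie_wedge hB hv, h.coord_lie h.mul_eq, coord_eq, wedge, sub_mulVec,
    vecMulVec_mulVec, vecMulVec_mulVec, dotProduct_sub]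
  simp only [dotProduct_smul, op_smul_eq_smul, smul_eq_mul, horth]
  have h0 : (1 : Matrix _ _ ℝ) (OffIndex.fst x) (OffIndex.snd x') *
      (1 : Matrix _ _ ℝ) (OffIndex.fst x') (OffIndex.snd x) = 0 := by
    by_cases e : OffIndex.fst x' = OffIndex.snd x
    · rw [Matrix.one_apply_ne fun e' => hne ⟨e, e'⟩, zero_mul]
    · rw [Matrix.one_apply_ne e, mul_zero]
  rw [h0, sub_zero]
  by_cases e : x = x'
  · subst e
    simp [OffIndex.fst, OffIndex.snd]
  · rw [if_neg e]
    by_cases e1 : OffIndex.fst x' = OffIndex.fst x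
    · have e2 : OffIndex.snd x ≠ OffIndex.snd x' := fun e2 => e (OffIndex.ext_fst_snd e1.symm e2)
      rw [Matrix.one_apply_ne e2]
      simp
    · rw [Matrix.one_apply_ne e1]
      simp

theorem hessian_offVec_offVec (hΛ : StronglyDisjoint Λ) (hB : α.IsCritical B)
    (hv : α.IsUnitEigen B v) (x x' : α.OffIndex) :
    hessian diagPotential (α.diag B) (α.offVec v x) (α.offVec v x') =
      if x = x' then -2 * (α.eig x.1.1.1 x.2.1 - α.eig x.1.1.2 x.2.2) *
        (mean (α.part x.1.1.1) - mean (α.part x.1.1.2)) else 0 := by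
  rw [hessian_offVec hΛ hB hv (offVec_mem_critNormal hΛ hB hv x).1, coord_offVec hB hv]
  by_cases e : x = x'
  · subst e
    simp only [if_true, OffIndex.fst, OffIndex.snd]
    ring
  · simp [e]

theorem eig_ne (x : α.OffIndex) : α.eig x.1.1.1 x.2.1 ≠ α.eig x.1.1.2 x.2.2 := fun e =>
  (ne_of_lt x.1.2) (congrArg Sigma.fst (α.eig_injective (a₁ := ⟨_, x.2.1⟩) (a₂ := ⟨_, x.2.2⟩) e))

theorem hessian_offVec_self_ne_zero (hΛ : StronglyDisjoint Λ) (hB : α.IsCritical B)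
    (hv : α.IsUnitEigen B v) (x : α.OffIndex) :
    hessian diagPotential (α.diag B) (α.offVec v x) (α.offVec v x) ≠ 0 := by
  rw [hessian_offVec_offVec hΛ hB hv, if_pos rfl]
  exact mul_ne_zero (mul_ne_zero (by norm_num) (sub_ne_zero.2 (eig_ne x)))
    (sub_ne_zero.2 (OffIndex.mean_ne hΛ x))

/-- The blocks `[Diag(e), B_p]` solve the equations for the diagonal. -/
theorem exists_block_skew (hΛ : StronglyDisjoint Λ) (hB : α.IsCritical B)
    (hu : α.IsHyperplaneBasis u) (p : Fin α.k) (t : Fin (α.size p - 1)) :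
    ∃ M : Matrix (Fin (α.size p)) (Fin (α.size p)) ℝ, (∃ e : Fin (α.size p) → ℝ, M = ⁅diagonal e, B p⁆) ∧
      ∀ a, ⁅B p, M⁆ a a = u p t a := by
  -- Each block is itself a critical point with a single level, where zero level sums means
  -- orthogonal to the vector of ones.
  have hc : B p ∈ critSlice (α.part p) fun _ => mean (α.part p) :=
    ⟨(hB p).1, (hB p).2, diagonal_lie_eq_zero_iff.2 fun _ _ h => absurd rfl h⟩
  obtain ⟨e, he⟩ := exists_diag_lie_eq (hΛ.subset (α.part_subset p)) hc
    (u := u p t) (fun i => by simpa using (hu p).1 t)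
  exact ⟨_, ⟨e, rfl⟩, he⟩

theorem exists_diagVec_eq
    (hΩ : ∀ p t, ∃ e : Fin (α.size p) → ℝ, Ω p t = ⁅diagonal e, B p⁆)
    (y : α.DiagIndex) :
    ∃ f : Fin Λ.card → ℝ, α.diagVec B Ω y = ⁅α.diag B, ⁅diagonal f, α.diag B⁆⁆ := by
  obtain ⟨e, he⟩ := hΩ y.1 y.2
  exact ⟨α.extend y.1 e, by rw [diagVec, he, diag_single_lie, diag_single_diagonal_lie]⟩

theorem diagVec_mem_critNormal
    (hB : α.IsCritical B)
    (hΩ : ∀ p t, ∃ e : Fin (α.size p) → ℝ, Ω p t = ⁅diagonal e, B p⁆)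
    (y : α.DiagIndex) :
    α.diagVec B Ω y ∈ critNormal α.level (α.diag B) := by
  obtain ⟨f, hf⟩ := exists_diagVec_eq hΩ y
  rw [hf]
  exact lie_diagonal_lie_mem_critNormal (α.diag_mem_critSlice hB) f

theorem diagonal_level_lie_diagVec
    (hB : α.IsCritical B)
    (hΩ : ∀ p t, ∃ e : Fin (α.size p) → ℝ, Ω p t = ⁅diagonal e, B p⁆)
    (y : α.DiagIndex) :
    ⁅diagonal α.level, α.diagVec B Ω y⁆ = 0 := by
  obtain ⟨f, hf⟩ := exists_diagVec_eq hΩ y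
  have hH := (α.diag_mem_critSlice hB).2.2
  rw [hf]
  exact lie_mem_block hH (diagonal_lie_lie hH f)

theorem diagVec_apply_self
    (hΩu : ∀ p t a, ⁅B p, Ω p t⁆ a a = u p t a)
    (y : α.DiagIndex) (x : Fin Λ.card) :
    α.diagVec B Ω y x x = α.extend y.1 (u y.1 y.2) x := by
  rw [diagVec, diag_single_apply_self]
  simp only [hΩu]

theorem hessian_diagVec
    (hB : α.IsCritical B)
    (hΩ : ∀ p t, ∃ e : Fin (α.size p) → ℝ, Ω p t = ⁅diagonal e, B p⁆)
    (hΩu : ∀ p t a, ⁅B p, Ω p t⁆ a a = u p t a)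
    (y : α.DiagIndex) {X : Mat Λ} (hX : X ∈ isoTangent (α.diag B)) :
    hessian diagPotential (α.diag B) (α.diagVec B Ω y) X =
      ∑ x, α.extend y.1 (u y.1 y.2) x * X x x := by
  rw [hessian_of_lie_eq_zero (α.diag_mem_critSlice hB) (diagVec_mem_critNormal hB hΩ y).1 hX
    (diagonal_level_lie_diagVec hB hΩ y)]
  simp only [diagVec_apply_self hΩu]

theorem hessian_diagVec_diagVec
    (hB : α.IsCritical B)
    (hΩ : ∀ p t, ∃ e : Fin (α.size p) → ℝ, Ω p t = ⁅diagonal e, B p⁆)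
    (hΩu : ∀ p t a, ⁅B p, Ω p t⁆ a a = u p t a)
    (hu : α.IsHyperplaneBasis u) (y y' : α.DiagIndex) :
    hessian diagPotential (α.diag B) (α.diagVec B Ω y) (α.diagVec B Ω y') =
      if y = y' then 1 else 0 := by
  rw [hessian_diagVec hB hΩ hΩu y (diagVec_mem_critNormal hB hΩ y').1]
  simp only [diagVec_apply_self hΩu]
  obtain ⟨p, t⟩ := y
  obtain ⟨q, t'⟩ := y'
  change α.extend p (u p t) ⬝ᵥ α.extend q (u q t') = _
  by_cases h : p = q
  · subst h
    rw [extend_dotProduct_self, (hu p).2]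
    by_cases ht : t = t' <;> simp [ht]
  · rw [extend_dotProduct_of_ne α h, if_neg fun e => h (congrArg Sigma.fst e)]

theorem hessian_diagVec_offVec
    (hB : α.IsCritical B)
    (hΩ : ∀ p t, ∃ e : Fin (α.size p) → ℝ, Ω p t = ⁅diagonal e, B p⁆)
    (hΩu : ∀ p t a, ⁅B p, Ω p t⁆ a a = u p t a)
    (hΛ : StronglyDisjoint Λ) (hv : α.IsUnitEigen B v)
    (y : α.DiagIndex) (x : α.OffIndex) :
    hessian diagPotential (α.diag B) (α.diagVec B Ω y) (α.offVec v x) = 0 := by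
  rw [hessian_diagVec hB hΩ hΩu y (offVec_mem_critNormal hΛ hB hv x).1]
  simp [offVec_apply_self hΛ hB hv]

/-- The off-block vectors force `X` to commute with `Diag(level)`. The block vectors then make each
block of its diagonal orthogonal to the hyperplane basis, and the block sums vanish because `X` is
tangent. -/
theorem eq_zero_of_hessian_basis
    (hB : α.IsCritical B)
    (hΩ : ∀ p t, ∃ e : Fin (α.size p) → ℝ, Ω p t = ⁅diagonal e, B p⁆)
    (hΩu : ∀ p t a, ⁅B p, Ω p t⁆ a a = u p t a)
    (hΛ : StronglyDisjoint Λ) (hv : α.IsUnitEigen B v)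
    (hu : α.IsHyperplaneBasis u) {X : Mat Λ} (hX : X ∈ critNormal α.level (α.diag B))
    (hoff : ∀ x, hessian diagPotential (α.diag B) X (α.offVec v x) = 0)
    (hdiag : ∀ y, hessian diagPotential (α.diag B) X (α.diagVec B Ω y) = 0) : X = 0 := by
  have hH := α.diag_mem_critSlice hB
  have hsym : Xᵀ = X := by
    obtain ⟨M, hM, rfl⟩ := hX.1
    exact lie_transpose_of_skew hH.1.1 hM
  have hco : ∀ x : α.OffIndex,
      ((α.frame v)ᵀ * X * α.frame v) (OffIndex.fst x) (OffIndex.snd x) = 0 := fun x => by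
    have := hoff x
    rw [hessian_offVec hΛ hB hv hX.1] at this
    exact (mul_eq_zero.1 this).resolve_left
      (mul_ne_zero (by norm_num) (sub_ne_zero.2 (OffIndex.mean_ne hΛ x)))
  have hd : ⁅diagonal α.level, X⁆ = 0 := by
    refine (isEigenframe_frame hB hv).diagonal_lie_eq_zero_of_coord diagonal_level_mul_frame ?_
    rintro ⟨p, a⟩ ⟨q, b⟩ hpq
    rcases lt_trichotomy p q with h | h | h
    · exact hco ⟨⟨(p, q), h⟩, a, b⟩
    · subst h
      exact absurd rfl hpq
    · rw [coord_symm hsym]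
      exact hco ⟨⟨(q, p), h⟩, b, a⟩
  refine eq_zero_of_mem_critNormal hH hX hd fun x => ?_
  obtain ⟨⟨p, a⟩, rfl⟩ := α.blockEquiv.surjective x
  have hz := eq_zero_of_orthogonal_hyperplane_basis (α.nonempty p).card_pos (hu p).1 (hu p).2
    (z := fun a => X (α.blockEquiv ⟨p, a⟩) (α.blockEquiv ⟨p, a⟩)) ?_ ?_
  · exact congrFun hz a
  · obtain ⟨M, hM, rfl⟩ := hX.1
    -- The indicator of a block gives a diagonal matrix commuting with `α.diag B`.
    have h1 := sum_mul_diag_lie (α.extend p fun _ => 1) (α.diag B) M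
    have h2 : ⁅diagonal (α.extend p fun _ => 1), α.diag B⁆ = 0 := by
      rw [← diag_single_diagonal_lie]
      have : ⁅(diagonal fun _ : Fin (α.size p) => (1 : ℝ)), B p⁆ = 0 := by simp [Ring.lie_def]
      rw [this, Pi.single_zero, diag]
      simp
    rw [h2, Matrix.zero_mul, trace_zero, sum_extend_mul] at h1
    simpa using h1
  · intro t
    have h1 := hdiag ⟨p, t⟩
    rw [hessian_comm hH hX.1 (diagVec_mem_critNormal hB hΩ _).1,
      hessian_diagVec hB hΩ hΩu ⟨p, t⟩ hX.1, sum_extend_mul] at h1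
    simpa [mul_comm] using h1

end OrderedPartition

end DiagPotential

/-! ### Assembly of the theorem -/

theorem mainTheorem3 (Λ : Finset ℝ) (hΛ : StronglyDisjoint Λ) :
    -- nondegeneracy on the normal space at every point of every `E_α`
    (∀ α : OrderedPartition Λ, ∀ H ∈ α.E,
      NondegenerateOn (hessian diagPotential H) (normalSpace α.E H)) ∧
    -- the explicit basis of the normal space that is orthogonal for the Hessian
    (∀ (α : OrderedPartition Λ) (B : α.Blocks), α.IsCritical B →
      ∀ v, α.IsUnitEigen B v → ∀ u, α.IsHyperplaneBasis u →
      ∃ Ω : ∀ i : Fin α.k, Fin (α.size i - 1) → Matrix (Fin (α.size i)) (Fin (α.size i)) ℝ,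
        (∀ i j, IsSkew (Ω i j) ∧ ∀ a, ⁅B i, Ω i j⁆ a a = u i j a) ∧
        LinearIndependent ℝ (Sum.elim (α.offVec v) (α.diagVec B Ω)) ∧
        (Submodule.span ℝ (Set.range (Sum.elim (α.offVec v) (α.diagVec B Ω))) : Set (Mat Λ)) =
          normalSpace α.E (α.diag B) ∧
        (∀ x x', x ≠ x' →
          hessian diagPotential (α.diag B) (α.offVec v x) (α.offVec v x') = 0) ∧
        (∀ x : α.OffIndex,
          hessian diagPotential (α.diag B) (α.offVec v x) (α.offVec v x) =
            -2 * (α.eig x.1.1.1 x.2.1 - α.eig x.1.1.2 x.2.2) *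
              (mean (α.part x.1.1.1) - mean (α.part x.1.1.2)) ∧
          hessian diagPotential (α.diag B) (α.offVec v x) (α.offVec v x) ≠ 0) ∧
        (∀ y y', hessian diagPotential (α.diag B) (α.diagVec B Ω y) (α.diagVec B Ω y') =
          if y = y' then 1 else 0) ∧
        (∀ x y,
          hessian diagPotential (α.diag B) (α.offVec v x) (α.diagVec B Ω y) = 0 ∧
          hessian diagPotential (α.diag B) (α.diagVec B Ω y) (α.offVec v x) = 0)) ∧
    -- invariance of the Hessian under conjugation by permutation matrices
    (∀ (σ : Equiv.Perm (Fin Λ.card)), ∀ H ∈ isoSym Λ,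
      permConj σ H ∈ isoSym Λ ∧
      ∀ X ∈ isoTangent H, ∀ Y ∈ isoTangent H,
        permConj σ X ∈ isoTangent (permConj σ H) ∧
        hessian diagPotential (permConj σ H) (permConj σ X) (permConj σ Y) =
          hessian diagPotential H X Y) ∧
    -- nondegeneracy on the normal space along every critical manifold in the orbit of an `E_α`
    (∀ (α : OrderedPartition Λ) (σ : Equiv.Perm (Fin Λ.card)), ∀ H ∈ permConj σ '' α.E,
      NondegenerateOn (hessian diagPotential H) (normalSpace (permConj σ '' α.E) H)) ∧
    -- the diagonal potential is a Morse-Bott function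
    IsMorseBott Λ diagPotential := by 
  have hloc : ∀ {S T : Set (Mat Λ)} (H : Mat Λ), S = T → ∀ᶠ X in 𝓝 H, X ∈ S ↔ X ∈ T :=
    fun _ h => Filter.Eventually.of_forall fun _ => by rw [h]
  refine ⟨fun α H hH => ?_, fun α B hB v hv u hu => ?_,
    fun σ H hH => ⟨permConj_mem_isoSym σ hH, fun X hX Y hY =>
      ⟨permConj_mem_isoTangent σ hX, hessian_permConj σ hH hX hY⟩⟩,
    fun α σ H hH => ?_, isMorseBott_diagPotential hΛ⟩
  · have hE := α.E_eq_critSlice hΛ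
    rw [hE] at hH
    rw [normalSpace_eq_critNormal hΛ hH (hloc H hE)]
    exact nondegenerateOn_critNormal hH
  -- The form `[Diag(e), B p]`, and not merely the prescribed diagonal, is what makes the resulting
  -- vectors normal.
  · choose Ω hΩ hΩu using fun p t => OrderedPartition.exists_block_skew hΛ hB hu p t
    have hH := α.diag_mem_critSlice hB
    have hoo := OrderedPartition.hessian_offVec_offVec hΛ hB hv
    have hdd := OrderedPartition.hessian_diagVec_diagVec hB hΩ hΩu hu
    have hdo := OrderedPartition.hessian_diagVec_offVec hB hΩ hΩu hΛ hv
    have hN := OrderedPartition.offVec_mem_critNormal hΛ hB hv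
    have hD := OrderedPartition.diagVec_mem_critNormal hB hΩ
    have hod := fun x y => (hessian_comm hH (hN x).1 (hD y).1).trans (hdo y x)
    have hne := OrderedPartition.hessian_offVec_self_ne_zero hΛ hB hv
    obtain ⟨hli, hspan⟩ := basis_of_hessian_orthogonal hH
      (s := Sum.elim (α.offVec v) (α.diagVec B Ω)) (by rintro (x | y); exacts [hN x, hD y])
      (by
        rintro (x | y) (x' | y') h
        · exact (hoo x x').trans (if_neg fun e => h (congrArg Sum.inl e))
        · exact hod x y'
        · exact hdo y x'
        · exact (hdd y y').trans (if_neg fun e => h (congrArg Sum.inr e)))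
      (by
        rintro (x | y)
        · exact hne x
        · exact ((hdd y y).trans (if_pos rfl)).symm ▸ one_ne_zero)
      (fun X hX h => OrderedPartition.eq_zero_of_hessian_basis hB hΩ hΩu hΛ hv hu hX
        (fun x => h (Sum.inl x)) fun y => h (Sum.inr y))
    refine ⟨Ω, fun p t => ⟨?_, hΩu p t⟩, hli, ?_, fun x x' h => (hoo x x').trans (if_neg h),
      fun x => ⟨(hoo x x).trans (if_pos rfl), hne x⟩, hdd, fun x y => ⟨hod x y, hdo y x⟩⟩
    · obtain ⟨e, he⟩ := hΩ p t
      rw [he]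
      exact isSkew_lie_of_symm (Matrix.diagonal_transpose e) (hB p).1.1
    · rw [hspan, normalSpace_eq_critNormal hΛ hH (hloc _ (α.E_eq_critSlice hΛ))]
  · have hE := (congrArg (permConj σ '' ·) (α.E_eq_critSlice hΛ)).trans
      (permConj_image_critSlice σ α.level)
    rw [hE] at hH
    rw [normalSpace_eq_critNormal hΛ hH (hloc H hE)]
    exact nondegenerateOn_critNormal hH
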